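/- Let $n\ge 1$ and $p\ge 0$ be integers. Let either $c_1,\dots,c_{p+1}\subset gl(n,\mathbb C)$ be conjugacy classes (orbits of $GL(n,\mathbb C)$ acting by conjugation), or $C_1,\dots,C_{p+1}\subset GL(n,\mathbb C)$ be conjugacy classes. Denote by $d_j$ the dimension of $c_j$ (resp. $C_j$) as a complex algebraic variety, and let $\kappa = 2n^2-\sum_{j=1}^{p+1} d_j$ be the index of rigidity. A tuple of $n\times n$ matrices is said to have trivial centralizer if the only matrices commuting with all its members are the scalar ones. Let $\mathcal V$ be the set of all $(p+1)$-tuples with trivial centralizer of matrices $A_j\in c_j$ such that $A_1+\dots+A_{p+1}=0$ (resp. of matrices $M_j\in C_j$ such that $M_1\cdots M_{p+1}=I$), regarded as a subset of the affine space $\mathbb C^{(p+1)n^2}$ of all $(p+1)$-tuples of matrices. If $\mathcal V$ is not empty, then $\mathcal V$ is a smooth locally closed subvariety of this affine space, and its dimension, both locally at every point and globally, equals $n^2+1-\kappa$. -/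

import Mathlib

noncomputable section

/-- The Zariski topology on the affine space `ℂ^ι`, pulled back from the prime spectrum of the
polynomial ring along `x ↦ {f | f(x) = 0}`. Its closed sets are exactly the common zero sets of
families of polynomials, see `isClosed_zariskiTopology_iff`. -/
@[reducible]
def zariskiTopology (ι : Type) : TopologicalSpace (ι → ℂ) :=
  TopologicalSpace.induced (MvPolynomial.pointToPoint (k := ℂ) (σ := ι)) inferInstance

theorem isClosed_zariskiTopology_iff {ι : Type} (S : Set (ι → ℂ)) :
    @IsClosed (ι → ℂ) (zariskiTopology ι) S ↔
      ∃ F : Set (MvPolynomial ι ℂ), S = {x | ∀ f ∈ F, MvPolynomial.eval x f = 0} := by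
  have key : ∀ (F : Set (MvPolynomial ι ℂ)),
      MvPolynomial.pointToPoint (k := ℂ) (σ := ι) ⁻¹' (PrimeSpectrum.zeroLocus F) =
        {x | ∀ f ∈ F, MvPolynomial.eval x f = 0} := by
    intro F
    ext x
    simp [MvPolynomial.pointToPoint, PrimeSpectrum.mem_zeroLocus, Set.subset_def,
      MvPolynomial.aeval_eq_eval]
  rw [isClosed_induced_iff]
  constructor
  · rintro ⟨t, ht, rfl⟩
    obtain ⟨F, rfl⟩ := (PrimeSpectrum.isClosed_iff_zeroLocus t).1 ht
    exact ⟨F, key F⟩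
  · rintro ⟨F, rfl⟩
    exact ⟨_, PrimeSpectrum.isClosed_zeroLocus F, key F⟩

/-- The dimension of a subset `S` of affine space: the Krull dimension of `S` with the topology
induced by the Zariski topology (`⊥` for the empty set). -/
def varietyDim {ι : Type} (S : Set (ι → ℂ)) : WithBot ℕ∞ :=
  @topologicalKrullDim S (TopologicalSpace.induced Subtype.val (zariskiTopology ι))

/-- `S ⊆ ℂ^ι` is, in a Zariski neighbourhood `{g ≠ 0}` of `x`, the zero set of `c = |ι| - d`
polynomials whose differentials at `x` are linearly independent. For `x ∈ S` this is the Jacobian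
criterion: near `x`, `S` is Zariski closed and smooth of dimension `d`. -/
def IsSmoothOfDimAt {ι : Type} [Fintype ι] (S : Set (ι → ℂ)) (d : ℕ) (x : ι → ℂ) : Prop :=
  ∃ (c : ℕ) (f : Fin c → MvPolynomial ι ℂ) (g : MvPolynomial ι ℂ),
    c + d = Fintype.card ι ∧
    MvPolynomial.eval x g ≠ 0 ∧
    (∀ y : ι → ℂ, MvPolynomial.eval y g ≠ 0 →
      (y ∈ S ↔ ∀ i, MvPolynomial.eval y (f i) = 0)) ∧
    LinearIndependent ℂ
      (fun (i : Fin c) (k : ι) => MvPolynomial.eval x (MvPolynomial.pderiv k (f i)))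

/-- `S` is a smooth (locally closed) subvariety of `ℂ^ι`, of dimension `d` at each of its
points. -/
def IsSmoothVariety {ι : Type} [Fintype ι] (S : Set (ι → ℂ)) (d : ℕ) : Prop :=
  ∀ x ∈ S, IsSmoothOfDimAt S d x

/-- A set of complex `n × n` matrices as a subset of the affine space of matrix entries. -/
def matrixPoints {n : ℕ} (S : Set (Matrix (Fin n) (Fin n) ℂ)) : Set (Fin n × Fin n → ℂ) :=
  (fun A k => A k.1 k.2) '' S

/-- A set of tuples of complex `n × n` matrices as a subset of the affine space of all their
entries. -/
def tuplePoints {m n : ℕ} (S : Set (Fin m → Matrix (Fin n) (Fin n) ℂ)) :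
    Set (Fin m × Fin n × Fin n → ℂ) :=
  (fun A k => A k.1 k.2.1 k.2.2) '' S

/-- The dimension `d(C)` of a set of matrices (used for conjugacy classes), as a natural
number. -/
def classDim {n : ℕ} (S : Set (Matrix (Fin n) (Fin n) ℂ)) : ℕ :=
  ((varietyDim (matrixPoints S)).unbotD 0).toNat

/-- The index of rigidity `κ = 2 n² - ∑ⱼ d(Cⱼ)`. -/
def rigidityIndex {m n : ℕ} (C : Fin m → Set (Matrix (Fin n) (Fin n) ℂ)) : ℤ :=
  2 * (n : ℤ) ^ 2 - ∑ j, (classDim (C j) : ℤ)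

/-- The only matrices commuting with all `A j` are the scalar ones. -/
def HasTrivialCentralizer {m n : ℕ} (A : Fin m → Matrix (Fin n) (Fin n) ℂ) : Prop :=
  Subalgebra.centralizer ℂ (Set.range A) = ⊥

/-- Tuples of matrices `A j ∈ c j` with trivial centralizer and `A₁ + ⋯ + A_m = 0`. -/
def additiveTuples {m n : ℕ} (c : Fin m → Set (Matrix (Fin n) (Fin n) ℂ)) :
    Set (Fin m → Matrix (Fin n) (Fin n) ℂ) :=
  {A | (∀ j, A j ∈ c j) ∧ ∑ j, A j = 0 ∧ HasTrivialCentralizer A}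

/-- Tuples of matrices `M j ∈ C j` with trivial centralizer and `M₁ ⋯ M_m = I`. -/
def multiplicativeTuples {m n : ℕ} (C : Fin m → Set (Matrix (Fin n) (Fin n) ℂ)) :
    Set (Fin m → Matrix (Fin n) (Fin n) ℂ) :=
  {M | (∀ j, M j ∈ C j) ∧ (List.ofFn M).prod = 1 ∧ HasTrivialCentralizer M}

/-- The conjugacy class in `gl(n, ℂ)` under `GL(n, ℂ)`, as a set of matrices. -/
def additiveClass {n : ℕ} (c : ConjClasses (Matrix (Fin n) (Fin n) ℂ)) :
    Set (Matrix (Fin n) (Fin n) ℂ) :=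
  c.carrier

/-- The conjugacy class in the group `GL(n, ℂ)`, as a set of matrices. -/
def multiplicativeClass {n : ℕ} (C : ConjClasses (Matrix.GeneralLinearGroup (Fin n) ℂ)) :
    Set (Matrix (Fin n) (Fin n) ℂ) :=
  (fun M : Matrix.GeneralLinearGroup (Fin n) ℂ => (M : Matrix (Fin n) (Fin n) ℂ)) '' C.carrier

end

/-! Write `Φ` for the sum or the product of the matrices, and `z_j` for the dimension of the
centralizer of a member of the `j`-th class. Near a point `A` of the variety, `z_j` equations are
used for each class together with all but one of the `n²` entries of the matrix equation for `Φ`.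
One diagonal entry can be dropped because the trace (resp. determinant) of `Φ` is constant on the
product of the classes, so the remaining entries determine it. Triviality of the centralizer is a
Zariski open condition and costs no equation.

The differentials of these equations at `A` are independent (`linearIndependent_differentials`). A
linear relation among them, tested on the tangent vectors `[A_j, Y]` of the classes, produces a
matrix `β` orthogonal for the trace form to all the corresponding derivatives of `Φ`. Cyclicity of
the trace then makes `β` commute with every `A_j`; hence `β` is scalar, and its entry at the dropped
position is zero, so `β = 0`. The codimension is therefore `∑ z_j + n² - 1`, and `d_j = n² - z_j`
turns this into dimension `n² + 1 - κ`.

The class equations (`exists_conj_equations`) come from the linear system `M P = P B`: the matrix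
`M` is conjugate to `B` exactly when the system has an invertible solution, and Cramer's rule
supplies a polynomial candidate `Q M`, equal to `1` at `M = B`.

Dimensions of sets are Krull dimensions, for the classes as well as for the variety.
`IsSmoothVariety.varietyDim_eq` identifies them with the dimension in the Jacobian criterion:
Krull's height theorem and Nakayama's lemma give the height of the point modulo the local equations,
and the Nullstellensatz compares chains of closed sets with chains of primes. -/

noncomputable section

/-! ### Heights at a point cut out by equations with independent differentials -/

namespace MvPolynomial

variable {ι : Type}

theorem mem_vanishingIdeal_singleton (x : ι → ℂ) (f : MvPolynomial ι ℂ) :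
    f ∈ vanishingIdeal ℂ {x} ↔ eval x f = 0 := by
  rw [mem_vanishingIdeal_singleton_iff, aeval_eq_eval]

theorem X_sub_C_mem_vanishingIdeal (x : ι → ℂ) (k : ι) :
    (X k - C (x k) : MvPolynomial ι ℂ) ∈ vanishingIdeal ℂ {x} := by
  simp

/-- The translation automorphism `f ↦ f(X + a)`. -/
def translate (a : ι → ℂ) : MvPolynomial ι ℂ ≃ₐ[ℂ] MvPolynomial ι ℂ :=
  AlgEquiv.ofAlgHom (aeval fun k => X k + C (a k)) (aeval fun k => X k - C (a k))
    (by ext k; simp [MvPolynomial.algebraMap_eq]) (by ext k; simp [MvPolynomial.algebraMap_eq])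

theorem eval_translate (a x : ι → ℂ) (f : MvPolynomial ι ℂ) :
    eval x (translate a f) = eval (x + a) f := by
  induction f using MvPolynomial.induction_on with
  | C a => simp [translate]
  | add p q hp hq => simp [hp, hq]
  | mul_X p i hp => simp [hp]; left; simp [translate]

variable [Fintype ι]

/-- The linear form `∑ₖ wₖ (Xₖ - xₖ)` centred at `x`. -/
def centredForm (x : ι → ℂ) : (ι → ℂ) →ₗ[ℂ] MvPolynomial ι ℂ where
  toFun w := ∑ k, C (w k) * (X k - C (x k))
  map_add' v w := by simp [add_mul, Finset.sum_add_distrib]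
  map_smul' a w := by simp [Finset.smul_sum, MvPolynomial.smul_eq_C_mul, mul_assoc]

theorem centredForm_apply (x w : ι → ℂ) :
    centredForm x w = ∑ k, C (w k) * (X k - C (x k)) := rfl

theorem centredForm_mem_vanishingIdeal (x w : ι → ℂ) :
    centredForm x w ∈ vanishingIdeal ℂ {x} :=
  Ideal.sum_mem _ fun k _ => Ideal.mul_mem_left _ _ (X_sub_C_mem_vanishingIdeal x k)

/-- First order Taylor expansion of a polynomial at a point. -/
theorem sub_taylor_mem_sq (x : ι → ℂ) (f : MvPolynomial ι ℂ) :
    f - C (eval x f) - centredForm x (fun k => eval x (pderiv k f)) ∈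
      (vanishingIdeal ℂ {x}) ^ 2 := by
  classical
  induction f using MvPolynomial.induction_on with
  | C a =>
    have : (fun k => eval x (pderiv k (C a : MvPolynomial ι ℂ))) = 0 := by ext k; simp
    rw [this]; simp
  | add p q hp hq =>
    have : (fun k => eval x (pderiv k (p + q))) =
      (fun k => eval x (pderiv k p)) + fun k => eval x (pderiv k q) := by ext k; simp
    rw [this, map_add, map_add, map_add]
    convert! Ideal.add_mem _ hp hq using 1
    ring
  | mul_X p i hp =>
    have : (fun k => eval x (pderiv k (p * X i))) =
      x i • (fun k => eval x (pderiv k p)) + eval x p • (Pi.single i (1 : ℂ)) := by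
      ext k
      by_cases hk : i = k
      · subst hk; simp [mul_comm, add_comm]
      · simp [pderiv_X_of_ne hk, Pi.single_eq_of_ne' hk, mul_comm]
    have h1 : centredForm x (Pi.single i (1 : ℂ)) = X i - C (x i) := by
      rw [centredForm_apply, Finset.sum_eq_single i] <;> simp +contextual
    rw [this, map_add, map_smul, map_smul, h1]
    -- The remainder of `p * X i` is `x i` times the remainder of `p` plus this product of two
    -- factors vanishing at `x`.
    have h2 : (p - C (eval x p)) * (X i - C (x i)) ∈ (vanishingIdeal ℂ {x}) ^ 2 := by
      rw [pow_two]
      refine Ideal.mul_mem_mul ?_ (X_sub_C_mem_vanishingIdeal x i)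
      simp
    convert! Ideal.add_mem _ (Ideal.mul_mem_left _ (C (x i)) hp) h2 using 1
    simp only [smul_eq_C_mul, map_mul, eval_X]
    ring

/-- By the Nullstellensatz every maximal ideal belongs to a point, and translations move any point
to any other, so all maximal ideals have the same height. Their supremum is the Krull dimension of
the polynomial ring. -/
theorem card_le_height_vanishingIdeal (x : ι → ℂ) :
    (Fintype.card ι : ℕ∞) ≤ (vanishingIdeal ℂ {x} : Ideal (MvPolynomial ι ℂ)).height := by
  have h := MvPolynomial.ringKrullDim_of_isNoetherianRing (R := ℂ) (ι := ι)
  have h2 : ringKrullDim (MvPolynomial ι ℂ) ≤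
      ((vanishingIdeal ℂ {x} : Ideal (MvPolynomial ι ℂ)).height : WithBot ℕ∞) := by
    rw [ringKrullDim_le_iff_isMaximal_height_le]
    intro I hI
    obtain ⟨y, rfl⟩ := isMaximal_iff_eq_vanishingIdeal_singleton.1 hI
    have := RingEquiv.height_comap (translate (x - y)).toRingEquiv (vanishingIdeal ℂ {y})
    rw [← this]
    refine le_of_eq ?_
    congr 2
    ext f
    simp only [Ideal.mem_comap, mem_vanishingIdeal_singleton]
    have := eval_translate (x - y) y f
    simp only [add_sub_cancel] at this
    rw [← this]; rfl
  rw [h, ringKrullDim_eq_zero_of_field, zero_add] at h2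
  rw [← Nat.card_eq_fintype_card]
  exact_mod_cast h2


/-- Krull's height theorem for a prime `m` which is generated up to `m²` by `f` and `d` more
elements. -/
theorem _root_.Ideal.height_map_quotient_le_of_le_sup {R α : Type*} [CommRing R]
    [IsNoetherianRing R] {m : Ideal R} (hp : m.IsPrime) {d : ℕ} (f : α → R) (l : Fin d → R)
    (hf : ∀ i, f i ∈ m) (hl : ∀ j, l j ∈ m)
    (hm : m ≤ Ideal.span (Set.range f ∪ Set.range l) ⊔ m • m) :
    (m.map (Ideal.Quotient.mk (Ideal.span (Set.range f)))).height ≤ d := by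
  have hspan : Ideal.span (Set.range f) ≤ m := by
    rw [Ideal.span_le]
    rintro _ ⟨i, rfl⟩
    exact hf i
  -- Nakayama without localizing: `r ≡ 1` modulo `m`, and `r` multiplies `m` into the ideal
  -- generated by `f` and `l`. Since `r ∉ m`, a prime below `m` containing `f` and `l` already
  -- contains `m`.
  obtain ⟨r, hr1, hr2⟩ := Submodule.exists_sub_one_mem_and_smul_le_of_fg_of_le_sup
    (I := m) (P := m) (N := Ideal.span (Set.range f ∪ Set.range l))
    (IsNoetherian.noetherian m) le_rfl hm
  have hmin : m.map (Ideal.Quotient.mk (Ideal.span (Set.range f))) ∈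
      (Ideal.span (Set.range fun j => Ideal.Quotient.mk (Ideal.span (Set.range f))
        (l j))).minimalPrimes := by
    refine ⟨⟨Ideal.isPrime_map_quotientMk_of_isPrime hspan, ?_⟩, ?_⟩
    · rw [Ideal.span_le]
      rintro _ ⟨j, rfl⟩
      exact Ideal.mem_map_of_mem _ (hl j)
    · rintro q ⟨hq, hlq⟩ hqm
      rw [Ideal.map_le_iff_le_comap]
      have hq' : (q.comap (Ideal.Quotient.mk (Ideal.span (Set.range f)))).IsPrime :=
        Ideal.IsPrime.comap _
      have hJq : Ideal.span (Set.range f ∪ Set.range l) ≤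
          q.comap (Ideal.Quotient.mk (Ideal.span (Set.range f))) := by
        rw [Ideal.span_le]
        rintro _ (⟨i, rfl⟩ | ⟨j, rfl⟩)
        · have : Ideal.Quotient.mk (Ideal.span (Set.range f)) (f i) = 0 :=
            Ideal.Quotient.eq_zero_iff_mem.2 (Ideal.subset_span ⟨i, rfl⟩)
          change Ideal.Quotient.mk (Ideal.span (Set.range f)) (f i) ∈ q
          rw [this]; exact q.zero_mem
        · exact hlq (Ideal.subset_span ⟨j, rfl⟩)
      have hrq : r ∉ q.comap (Ideal.Quotient.mk (Ideal.span (Set.range f))) := by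
        intro hr
        have h1 : r ∈ m := by
          have := Ideal.comap_mono (f := Ideal.Quotient.mk (Ideal.span (Set.range f))) hqm hr
          rwa [Ideal.comap_map_quotientMk, sup_eq_right.2 hspan] at this
        have h2 : (1 : R) ∈ m := by
          have := sub_mem h1 hr1
          simpa using this
        exact hp.ne_top ((Ideal.eq_top_iff_one _).2 h2)
      intro y hy
      have h1 : r * y ∈ Ideal.span (Set.range f ∪ Set.range l) :=
        hr2 (Submodule.smul_mem_pointwise_smul y r m hy)
      exact (hq'.mem_or_mem (hJq h1)).resolve_left hrq
  refine (Ideal.height_le_card_of_mem_minimalPrimes_span (Set.finite_range _) hmin).trans ?_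
  have := Finite.card_range_le fun j => Ideal.Quotient.mk (Ideal.span (Set.range f)) (l j)
  rw [← Nat.card_coe_set_eq]
  simp only [Nat.card_eq_fintype_card, Fintype.card_fin] at this
  exact_mod_cast this

/-- Polynomials with linearly independent differentials extend to a generating system of the
ideal of a point modulo its square. -/
theorem exists_forms_vanishingIdeal_le {c d : ℕ} (hcd : c + d = Fintype.card ι) (x : ι → ℂ)
    (f : Fin c → MvPolynomial ι ℂ) (hf : ∀ i, eval x (f i) = 0)
    (hli : LinearIndependent ℂ fun (i : Fin c) (k : ι) => eval x (pderiv k (f i))) :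
    ∃ l : Fin d → MvPolynomial ι ℂ, (∀ j, l j ∈ vanishingIdeal ℂ {x}) ∧
      vanishingIdeal ℂ {x} ≤ Ideal.span (Set.range f ∪ Set.range l) ⊔
        (vanishingIdeal ℂ {x}) ^ 2 := by
  -- A basis of a complement to the span of the differentials supplies the `d` missing linear forms.
  obtain ⟨U, hU⟩ := Submodule.exists_isCompl
    (Submodule.span ℂ (Set.range fun (i : Fin c) (k : ι) => eval x (pderiv k (f i))))
  have hUd : Module.finrank ℂ U = d := by
    have h1 := Submodule.finrank_add_eq_of_isCompl hU
    rw [finrank_span_eq_card hli] at h1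
    simp at h1
    omega
  let b := Module.finBasisOfFinrankEq ℂ U hUd
  refine ⟨fun j => centredForm x (b j : ι → ℂ), fun j => centredForm_mem_vanishingIdeal x _, ?_⟩
  set K : Ideal (MvPolynomial ι ℂ) :=
    Ideal.span (Set.range f ∪ Set.range fun j => centredForm x (b j : ι → ℂ)) ⊔
        (vanishingIdeal ℂ {x}) ^ 2 with hK
  have hform : ∀ w, centredForm x w ∈ K := by
    let Wsub : Submodule ℂ (ι → ℂ) := (K.restrictScalars ℂ).comap (centredForm x)
    suffices hW : Wsub = ⊤ by
      intro w
      have : w ∈ Wsub := hW ▸ Submodule.mem_top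
      exact this
    rw [eq_top_iff, ← hU.sup_eq_top, sup_le_iff]
    constructor
    · rw [Submodule.span_le]
      rintro _ ⟨i, rfl⟩
      change centredForm x _ ∈ K
      have h1 := sub_taylor_mem_sq x (f i)
      rw [hf i, map_zero, sub_zero] at h1
      have h2 : f i ∈ K := Ideal.mem_sup_left (Ideal.subset_span (Or.inl ⟨i, rfl⟩))
      have h3 := sub_mem h2 (Ideal.mem_sup_right h1 : _ ∈ K)
      rwa [sub_sub_cancel] at h3
    · have h2 : Submodule.span ℂ (Set.range b) ≤ Wsub.comap U.subtype := by
        rw [Submodule.span_le]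
        rintro _ ⟨j, rfl⟩
        change centredForm x (b j : ι → ℂ) ∈ K
        exact Ideal.mem_sup_left (Ideal.subset_span (Or.inr ⟨j, rfl⟩))
      rw [b.span_eq] at h2
      intro u hu
      exact h2 (x := ⟨u, hu⟩) trivial
  intro h hh
  have h1 := sub_taylor_mem_sq x h
  rw [(mem_vanishingIdeal_singleton x h).1 hh, map_zero, sub_zero] at h1
  have h3 := add_mem (Ideal.mem_sup_right h1 : _ ∈ K) (hform fun k => eval x (pderiv k h))
  rwa [sub_add_cancel] at h3

/-- If the differentials of `f` at `x` are linearly independent, the local ring at `x` of the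
zero scheme of `f` has the expected dimension. -/
theorem height_map_quotient_span_range {c d : ℕ} (hcd : c + d = Fintype.card ι) (x : ι → ℂ)
    (f : Fin c → MvPolynomial ι ℂ) (hf : ∀ i, eval x (f i) = 0)
    (hli : LinearIndependent ℂ fun (i : Fin c) (k : ι) => eval x (pderiv k (f i))) :
    ((vanishingIdeal ℂ {x}).map (Ideal.Quotient.mk (Ideal.span (Set.range f)))).height =
      (d : ℕ∞) := by
  have hfm : ∀ i, f i ∈ vanishingIdeal ℂ {x} := fun i =>
    (mem_vanishingIdeal_singleton x _).2 (hf i)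
  apply le_antisymm
  · obtain ⟨l, hl, hm⟩ := exists_forms_vanishingIdeal_le hcd x f hf hli
    rw [pow_two] at hm
    exact Ideal.height_map_quotient_le_of_le_sup inferInstance f l hfm hl hm
  · have h1 := card_le_height_vanishingIdeal x
    have h2 := Ideal.height_le_height_add_encard_of_subset (Set.range f)
      (p := vanishingIdeal ℂ {x}) (by rintro _ ⟨i, rfl⟩; exact hfm i)
    have h3 : (Set.range f).encard ≤ c := by
      have := Set.encard_image_le f Set.univ
      simpa using this
    -- Dividing by `c` elements lowers the height by at most `c`, from at least `c + d`.
    have h4 := (h1.trans h2).trans (add_le_add_right h3 _)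
    rw [← hcd] at h4
    push_cast at h4
    rw [add_comm] at h4
    exact (ENat.add_le_add_iff_right (ENat.natCast_ne_top c)).1 h4

end MvPolynomial

/-! ### Krull dimension of subspaces of a prime spectrum -/

open TopologicalSpace PrimeSpectrum in
/-- A chain of irreducible closed sets through a point `x` of a subspace of `Spec R` on which `I`
vanishes is bounded by the dimension of `R ⧸ I` at `x`. -/
theorem length_le_height_map_of_isInducing {R X : Type*} [CommRing R] [TopologicalSpace X]
    {j : X → PrimeSpectrum R} (hj : Topology.IsInducing j) (I : Ideal R)
    (l : LTSeries (IrreducibleCloseds X))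
    (hI : I ≤ vanishingIdeal (j '' (l.last : Set X))) {x : X} (hx : x ∈ (l.head : Set X)) :
    (l.length : ℕ∞) ≤ ((j x).asIdeal.map (Ideal.Quotient.mk I)).height := by
  -- The generic point of the closure of the image of `Z`. Larger closed sets have smaller primes,
  -- so the chain is reversed below.
  let P : IrreducibleCloseds X → PrimeSpectrum R := fun Z =>
    ⟨vanishingIdeal (j '' (Z : Set X)), isIrreducible_iff_vanishingIdeal_isPrime.1
      (Z.isIrreducible.image j hj.continuous.continuousOn)⟩
  have hPmono : ∀ {Z Z'}, Z < Z' → P Z' < P Z := by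
    intro Z Z' h
    refine lt_of_le_of_ne (vanishingIdeal_anti_mono (Set.image_mono h.le)) fun he => h.ne ?_
    have he' : vanishingIdeal (j '' (Z' : Set X)) = vanishingIdeal (j '' (Z : Set X)) :=
      congrArg PrimeSpectrum.asIdeal he
    apply IrreducibleCloseds.map_injective_of_isInducing hj
    apply SetLike.coe_injective
    rw [IrreducibleCloseds.coe_map, IrreducibleCloseds.coe_map,
      ← zeroLocus_vanishingIdeal_eq_closure, ← zeroLocus_vanishingIdeal_eq_closure, he']
  have hPI : ∀ i, P (l i) ∈ zeroLocus (I : Set R) := fun i =>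
    hI.trans (vanishingIdeal_anti_mono (Set.image_mono (l.monotone (Fin.le_last i))))
  let e := I.primeSpectrumQuotientOrderIsoZeroLocus
  let s : LTSeries (PrimeSpectrum (R ⧸ I)) := LTSeries.mk l.length
    (fun i => e.symm ⟨P (l i.rev), hPI _⟩) (by
      intro a b hab
      apply e.symm.strictMono
      exact hPmono (l.strictMono (Fin.rev_lt_rev.2 hab)))
  have hx0 : I ≤ (j x).asIdeal := by
    refine (hPI 0).trans fun f hf => ?_
    exact (mem_vanishingIdeal _ f).1 hf _ ⟨x, hx, rfl⟩
  have hp : ((j x).asIdeal.map (Ideal.Quotient.mk I)).IsPrime :=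
    Ideal.isPrime_map_quotientMk_of_isPrime hx0
  rw [height_eq_orderHeight ⟨_, hp⟩]
  refine Order.length_le_height (p := s) ?_
  have h1 : s.last = e.symm ⟨P (l 0), hPI 0⟩ := by
    change e.symm ⟨P (l (Fin.last l.length).rev), hPI _⟩ = _
    congr 3
    simp
  rw [h1, ← e.le_iff_le, e.apply_symm_apply]
  change vanishingIdeal _ ≤ Ideal.comap (Ideal.Quotient.mk I) _
  rw [Ideal.comap_map_quotientMk, sup_eq_right.2 hx0]
  intro f hf
  exact (mem_vanishingIdeal _ f).1 hf _ ⟨x, hx, rfl⟩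

open TopologicalSpace PrimeSpectrum in
/-- If `X → Spec R` is inducing and the image of `X` is dense in `V(q)` for all primes
`I ⊆ q ⊆ j x`, then `X` has at least the dimension of `R ⧸ I` at `x`. -/
theorem le_topologicalKrullDim_of_isInducing {R X : Type*} [CommRing R] [TopologicalSpace X]
    {j : X → PrimeSpectrum R} (hj : Topology.IsInducing j) (I : Ideal R) {x : X}
    (hx : I ≤ (j x).asIdeal)
    (hq : ∀ q : Ideal R, q.IsPrime → I ≤ q → q ≤ (j x).asIdeal →
      vanishingIdeal (j '' (j ⁻¹' zeroLocus (q : Set R))) = q)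
    {d : ℕ} (hd : (d : ℕ∞) ≤ ((j x).asIdeal.map (Ideal.Quotient.mk I)).height) :
    (d : WithBot ℕ∞) ≤ topologicalKrullDim X := by
  have hp : ((j x).asIdeal.map (Ideal.Quotient.mk I)).IsPrime :=
    Ideal.isPrime_map_quotientMk_of_isPrime hx
  rw [height_eq_orderHeight ⟨_, hp⟩] at hd
  obtain ⟨s, hs, rfl⟩ := Order.exists_series_of_le_height _ hd
  let q : Fin (s.length + 1) → Ideal R := fun i => (s i).asIdeal.comap (Ideal.Quotient.mk I)
  have hqp : ∀ i, (q i).IsPrime := fun i => Ideal.IsPrime.comap _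
  have hIq : ∀ i, I ≤ q i := fun i => by
    conv_lhs => rw [← Ideal.mk_ker (I := I)]
    exact Ideal.comap_mono bot_le
  have hqx : ∀ i, q i ≤ (j x).asIdeal := fun i => by
    have h1 : s i ≤ s.last := s.monotone (Fin.le_last i)
    rw [hs] at h1
    have h2 : (s i).asIdeal ≤ (j x).asIdeal.map (Ideal.Quotient.mk I) := h1
    refine (Ideal.comap_mono h2).trans ?_
    rw [Ideal.comap_map_quotientMk, sup_eq_right.2 hx]
  have hqm : StrictMono q := fun a b hab => by
    have h1 : s a < s b := s.strictMono hab
    refine lt_of_le_of_ne (Ideal.comap_mono h1.le) fun he => h1.ne ?_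
    exact PrimeSpectrum.ext (Ideal.comap_injective_of_surjective _ Ideal.Quotient.mk_surjective he)
  have hvan := fun i => hq (q i) (hqp i) (hIq i) (hqx i)
  -- The image of `Z i` is irreducible because its vanishing ideal is the prime `q i`;
  -- irreducibility passes back to `X` since its open sets are pulled back along `j`.
  let Z : Fin (s.length + 1) → IrreducibleCloseds X := fun i =>
    { carrier := j ⁻¹' zeroLocus (q i : Set R)
      isClosed' := (isClosed_zeroLocus _).preimage hj.continuous
      isIrreducible' := by
        have hirr : IsIrreducible (j '' (j ⁻¹' zeroLocus (q i : Set R))) := by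
          rw [isIrreducible_iff_vanishingIdeal_isPrime, hvan i]
          exact hqp i
        refine ⟨hirr.1.of_image, ?_⟩
        rintro u v hu hv ⟨y, hy, hyu⟩ ⟨z, hz, hzv⟩
        obtain ⟨u', hu', rfl⟩ := hj.isOpen_iff.1 hu
        obtain ⟨v', hv', rfl⟩ := hj.isOpen_iff.1 hv
        obtain ⟨_, ⟨w, hw, rfl⟩, hwu, hwv⟩ := hirr.2 u' v' hu' hv' ⟨j y, ⟨y, hy, rfl⟩, hyu⟩
          ⟨j z, ⟨z, hz, rfl⟩, hzv⟩
        exact ⟨w, hw, hwu, hwv⟩ }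
  have hZ : ∀ {a b}, a < b → Z b < Z a := by
    intro a b hab
    refine lt_of_le_of_ne ?_ fun he => (hqm hab).ne ?_
    · intro y hy
      exact (hqm hab).le.trans hy
    · have he' : j ⁻¹' zeroLocus (q b : Set R) = j ⁻¹' zeroLocus (q a : Set R) :=
        congrArg (fun T : IrreducibleCloseds X => (T : Set X)) he
      rw [← hvan a, ← hvan b, he']
  exact Order.LTSeries.length_le_krullDim (LTSeries.mk s.length (fun i => Z i.rev)
    fun a b hab => hZ (Fin.rev_lt_rev.2 hab))

open MvPolynomial in
/-- The global dimension of a nonempty smooth variety is its local dimension. -/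
theorem IsSmoothVariety.varietyDim_eq {ι : Type} [Fintype ι] {S : Set (ι → ℂ)} {d : ℕ}
    (hS : IsSmoothVariety S d) (hne : S.Nonempty) : varietyDim S = d := by
  let _ := zariskiTopology ι
  have hpt : Topology.IsInducing (pointToPoint (k := ℂ) (K := ℂ) (σ := ι)) := ⟨rfl⟩
  have hpx : ∀ x : ι → ℂ, (pointToPoint (k := ℂ) x).asIdeal = vanishingIdeal ℂ {x} := fun _ => rfl
  change topologicalKrullDim S = d
  apply le_antisymm
  · refine iSup_le fun l => ?_
    obtain ⟨x, hx⟩ := l.head.isIrreducible.nonempty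
    obtain ⟨c, f, g, hcd, hg, hloc, hli⟩ := hS x x.2
    have hfx := (hloc x hg).1 x.2
    have hxl : x ∈ (l.last : Set S) := l.head_le_last hx
    have hjS : Topology.IsInducing fun y : S => pointToPoint (k := ℂ) (y : ι → ℂ) :=
      hpt.comp Topology.IsInducing.subtypeVal
    have hprime := PrimeSpectrum.isIrreducible_iff_vanishingIdeal_isPrime.1
      (l.last.isIrreducible.image _ hjS.continuous.continuousOn)
    have hmem : ∀ (h : MvPolynomial ι ℂ), h ∈ PrimeSpectrum.vanishingIdeal
        ((fun y : S => pointToPoint (k := ℂ) (y : ι → ℂ)) '' (l.last : Set S)) ↔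
        ∀ y ∈ (l.last : Set S), eval (y : ι → ℂ) h = 0 := by
      intro h
      rw [PrimeSpectrum.mem_vanishingIdeal, Set.forall_mem_image]
      exact forall₂_congr fun y _ => by
        rw [hpx, mem_vanishingIdeal_singleton]
    have key := length_le_height_map_of_isInducing hjS (Ideal.span (Set.range f)) l (by
      rw [Ideal.span_le]
      rintro _ ⟨i, rfl⟩
      -- The equations hold only where `g ≠ 0`, but `f i * g` vanishes on all of `S`. As `g x ≠ 0`
      -- and the vanishing ideal is prime, `f i` itself lies in it.
      have h1 : f i * g ∈ PrimeSpectrum.vanishingIdeal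
          ((fun y : S => pointToPoint (k := ℂ) (y : ι → ℂ)) '' (l.last : Set S)) := by
        rw [hmem]
        intro y hy
        rw [map_mul]
        by_cases hgy : eval (y : ι → ℂ) g = 0
        · rw [hgy, mul_zero]
        · rw [(hloc y hgy).1 y.2 i, zero_mul]
      exact (hprime.mem_or_mem h1).resolve_right fun h => hg ((hmem g).1 h x hxl)) hx
    rw [hpx, height_map_quotient_span_range hcd x f hfx hli] at key
    exact_mod_cast key
  · obtain ⟨x, hx⟩ := hne
    obtain ⟨c, f, g, hcd, hg, hloc, hli⟩ := hS x hx
    have hfx := (hloc x hg).1 hx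
    -- On this part `S` is exactly the zero set of `f`, and passing to a subspace can only lower the
    -- dimension.
    let T : Set (ι → ℂ) := S ∩ {y | eval y g ≠ 0}
    have hjT : Topology.IsInducing fun y : T => pointToPoint (k := ℂ) (y : ι → ℂ) :=
      hpt.comp Topology.IsInducing.subtypeVal
    have hTS : Topology.IsInducing (Set.inclusion (Set.inter_subset_left : T ⊆ S)) :=
      (Topology.IsEmbedding.inclusion Set.inter_subset_left).isInducing
    refine le_trans ?_ hTS.topologicalKrullDim_le
    refine le_topologicalKrullDim_of_isInducing hjT (Ideal.span (Set.range f))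
      (x := ⟨x, hx, hg⟩) ?_ ?_ (height_map_quotient_span_range hcd x f hfx hli).ge
    · rw [Ideal.span_le]
      rintro _ ⟨i, rfl⟩
      exact (mem_vanishingIdeal_singleton x _).2 (hfx i)
    · intro q hq hfq hqx
      ext h
      rw [PrimeSpectrum.mem_vanishingIdeal, Set.forall_mem_image]
      have hgq : g ∉ q := fun h => hg ((mem_vanishingIdeal_singleton x g).1 (hqx h))
      constructor
      · intro hh
        -- By the Nullstellensatz it suffices that `h * g` vanishes on the zeros of `q`. Such a zero
        -- with `g ≠ 0` satisfies all `f i`, hence lies in `T`, where `h` vanishes.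
        refine (hq.mem_or_mem (?_ : h * g ∈ q)).resolve_right hgq
        rw [← IsPrime.vanishingIdeal_zeroLocus (K := ℂ) q, mem_vanishingIdeal_iff]
        intro y hy
        rw [aeval_eq_eval, map_mul]
        by_cases hgy : eval y g = 0
        · rw [hgy, mul_zero]
        · have hyS : y ∈ S := (hloc y hgy).2 fun i => by
            have := hy (f i) (hfq (Ideal.subset_span ⟨i, rfl⟩))
            rwa [aeval_eq_eval] at this
          have h1 := hh (x := ⟨y, hyS, hgy⟩) (by
            intro p hp
            have := hy p hp
            exact (mem_vanishingIdeal_singleton_iff y p).2 this)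
          rw [(mem_vanishingIdeal_singleton y h).1 h1, zero_mul]
      · intro hh y hy
        exact hy hh

/-! ### Polynomial functions and maps -/

/-- The algebra of polynomial functions on a complex vector space. -/
def polyFun (E : Type*) [AddCommGroup E] [Module ℂ E] : Subalgebra ℂ (E → ℂ) :=
  Algebra.adjoin ℂ (Set.range fun l : Module.Dual ℂ E => (l : E → ℂ))

/-- A map between complex vector spaces whose coordinates are polynomial functions. -/
def IsPolyMap {E V : Type*} [AddCommGroup E] [Module ℂ E] [AddCommGroup V] [Module ℂ V]
    (Φ : E → V) : Prop :=
  ∀ l : Module.Dual ℂ V, (fun x => l (Φ x)) ∈ polyFun E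

section

variable {E V W : Type*} [AddCommGroup E] [Module ℂ E] [AddCommGroup V] [Module ℂ V]
  [AddCommGroup W] [Module ℂ W]

theorem linear_mem_polyFun (l : Module.Dual ℂ E) : (fun x => l x) ∈ polyFun E :=
  Algebra.subset_adjoin ⟨l, rfl⟩

theorem const_mem_polyFun (a : ℂ) : (fun _ : E => a) ∈ polyFun E :=
  (polyFun E).algebraMap_mem a

theorem mul_mem_polyFun {F G : E → ℂ} (hF : F ∈ polyFun E) (hG : G ∈ polyFun E) :
    (fun x => F x * G x) ∈ polyFun E :=
  mul_mem hF hG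

theorem sum_mem_polyFun {α : Type*} (s : Finset α) {F : α → E → ℂ}
    (hF : ∀ i ∈ s, F i ∈ polyFun E) : (fun x => ∑ i ∈ s, F i x) ∈ polyFun E := by
  convert! sum_mem hF
  simp

theorem prod_mem_polyFun {α : Type*} (s : Finset α) {F : α → E → ℂ}
    (hF : ∀ i ∈ s, F i ∈ polyFun E) : (fun x => ∏ i ∈ s, F i x) ∈ polyFun E := by
  convert! prod_mem hF
  simp

/-- A polynomial function has a linear differential. -/
theorem exists_hasDerivAt_of_mem_polyFun {F : E → ℂ} (hF : F ∈ polyFun E) (x : E) :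
    ∃ l : Module.Dual ℂ E, ∀ v, HasDerivAt (fun t : ℂ => F (x + t • v)) (l v) 0 := by
  induction hF using Algebra.adjoin_induction with
  | mem F hF =>
    obtain ⟨l, rfl⟩ := hF
    refine ⟨l, fun v => ?_⟩
    simpa using! ((hasDerivAt_id (0 : ℂ)).mul_const (l v)).const_add (l x)
  | algebraMap a => exact ⟨0, fun v => hasDerivAt_const _ a⟩
  | add F G _ _ hF hG =>
    obtain ⟨l, hl⟩ := hF
    obtain ⟨k, hk⟩ := hG
    exact ⟨l + k, fun v => (hl v).add (hk v)⟩
  | mul F G _ _ hF hG =>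
    obtain ⟨l, hl⟩ := hF
    obtain ⟨k, hk⟩ := hG
    refine ⟨G x • l + F x • k, fun v => ?_⟩
    convert! (hl v).mul (hk v) using 1
    simp [mul_comm]

theorem comp_linear_mem_polyFun {F : V → ℂ} (hF : F ∈ polyFun V) (T : E →ₗ[ℂ] V) :
    (fun x => F (T x)) ∈ polyFun E := by
  induction hF using Algebra.adjoin_induction with
  | mem F hF =>
    obtain ⟨l, rfl⟩ := hF
    exact linear_mem_polyFun (l.comp T)
  | algebraMap a => exact const_mem_polyFun a
  | add F G _ _ hF hG => exact add_mem hF hG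
  | mul F G _ _ hF hG => exact mul_mem hF hG

theorem exists_mvPolynomial_of_mem_polyFun {ι : Type*} [Fintype ι] {F : E → ℂ}
    (hF : F ∈ polyFun E) (e : E ≃ₗ[ℂ] (ι → ℂ)) :
    ∃ f : MvPolynomial ι ℂ, ∀ x, MvPolynomial.eval (e x) f = F x := by
  classical
  induction hF using Algebra.adjoin_induction with
  | mem F hF =>
    obtain ⟨l, rfl⟩ := hF
    refine ⟨∑ k, MvPolynomial.C (l (e.symm (Pi.single k 1))) * MvPolynomial.X k, fun x => ?_⟩
    have h : x = e.symm (∑ k, e x k • Pi.single k 1) := by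
      rw [← pi_eq_sum_univ', e.symm_apply_apply]
    conv_rhs => rw [h]
    simp [mul_comm]
  | algebraMap a => exact ⟨MvPolynomial.C a, fun x => by simp⟩
  | add F G _ _ hF hG =>
    obtain ⟨f, hf⟩ := hF
    obtain ⟨g, hg⟩ := hG
    exact ⟨f + g, fun x => by simp [hf, hg]⟩
  | mul F G _ _ hF hG =>
    obtain ⟨f, hf⟩ := hF
    obtain ⟨g, hg⟩ := hG
    exact ⟨f * g, fun x => by simp [hf, hg]⟩

theorem IsPolyMap.linear (T : E →ₗ[ℂ] V) : IsPolyMap fun x => T x :=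
  fun l => linear_mem_polyFun (l.comp T)

theorem IsPolyMap.const (v : V) : IsPolyMap fun _ : E => v :=
  fun l => const_mem_polyFun (l v)

theorem IsPolyMap.sub {Φ Ψ : E → V} (hΦ : IsPolyMap Φ) (hΨ : IsPolyMap Ψ) :
    IsPolyMap fun x => Φ x - Ψ x := fun l => by
  simpa only [map_sub] using! sub_mem (hΦ l) (hΨ l)

theorem IsPolyMap.smul {F : E → ℂ} {Φ : E → V} (hF : F ∈ polyFun E) (hΦ : IsPolyMap Φ) :
    IsPolyMap fun x => F x • Φ x := fun l => by
  simpa only [map_smul, smul_eq_mul] using mul_mem_polyFun hF (hΦ l)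

theorem IsPolyMap.linear_comp {Φ : E → V} (hΦ : IsPolyMap Φ) (T : V →ₗ[ℂ] W) :
    IsPolyMap fun x => T (Φ x) :=
  fun l => hΦ (l.comp T)

theorem IsPolyMap.apply {α : Type*} {Φ : E → α → ℂ} (hΦ : IsPolyMap Φ) (i : α) :
    (fun x => Φ x i) ∈ polyFun E :=
  hΦ (LinearMap.proj i)

theorem IsPolyMap.of_apply {α : Type*} [Fintype α] {Φ : E → α → ℂ}
    (hΦ : ∀ i, (fun x => Φ x i) ∈ polyFun E) : IsPolyMap Φ := fun l => by
  classical
  have h : ∀ x, l (Φ x) = ∑ i, Φ x i * l (Pi.single i 1) := fun x => by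
    conv_lhs => rw [pi_eq_sum_univ' (Φ x)]
    simp
  simp only [h]
  exact sum_mem_polyFun _ fun i _ => mul_mem_polyFun (hΦ i) (const_mem_polyFun _)

variable {α β γ : Type*}

theorem IsPolyMap.entry {Φ : E → Matrix α β ℂ} (hΦ : IsPolyMap Φ) (i : α) (j : β) :
    (fun x => Φ x i j) ∈ polyFun E :=
  hΦ (Matrix.entryLinearMap ℂ ℂ i j)

theorem IsPolyMap.of_entry [Fintype α] [Fintype β] {Φ : E → Matrix α β ℂ}
    (hΦ : ∀ i j, (fun x => Φ x i j) ∈ polyFun E) : IsPolyMap Φ := fun l => by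
  classical
  have h : ∀ x, l (Φ x) = ∑ i, ∑ j, Φ x i j * l (Matrix.single i j 1) := fun x => by
    conv_lhs => rw [Matrix.matrix_eq_sum_single (Φ x)]
    simp only [map_sum]
    refine Finset.sum_congr rfl fun i _ => Finset.sum_congr rfl fun j _ => ?_
    rw [← smul_eq_mul, ← map_smul, Matrix.smul_single, smul_eq_mul, mul_one]
  simp only [h]
  exact sum_mem_polyFun _ fun i _ => sum_mem_polyFun _ fun j _ =>
    mul_mem_polyFun (hΦ i j) (const_mem_polyFun _)

theorem IsPolyMap.matrix_mul [Fintype α] [Fintype β] [Fintype γ] {Φ : E → Matrix α β ℂ}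
    {Ψ : E → Matrix β γ ℂ} (hΦ : IsPolyMap Φ) (hΨ : IsPolyMap Ψ) :
    IsPolyMap fun x => Φ x * Ψ x := by
  refine IsPolyMap.of_entry fun i j => ?_
  simp only [Matrix.mul_apply]
  exact sum_mem_polyFun _ fun k _ => mul_mem_polyFun (hΦ.entry i k) (hΨ.entry k j)

theorem IsPolyMap.mulVec [Fintype α] [Fintype β] {Φ : E → Matrix α β ℂ}
    {Ψ : E → β → ℂ} (hΦ : IsPolyMap Φ) (hΨ : IsPolyMap Ψ) :
    IsPolyMap fun x => (Φ x).mulVec (Ψ x) := by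
  refine IsPolyMap.of_apply fun i => ?_
  simp only [Matrix.mulVec, dotProduct]
  exact sum_mem_polyFun _ fun k _ => mul_mem_polyFun (hΦ.entry i k) (hΨ.apply k)

theorem IsPolyMap.det [Fintype α] [DecidableEq α] {Φ : E → Matrix α α ℂ} (hΦ : IsPolyMap Φ) :
    (fun x => (Φ x).det) ∈ polyFun E := by
  simp only [Matrix.det_apply']
  exact sum_mem_polyFun _ fun σ _ => mul_mem_polyFun (const_mem_polyFun _)
    (prod_mem_polyFun _ fun i _ => hΦ.entry _ _)

theorem IsPolyMap.adjugate [Fintype α] [DecidableEq α] {Φ : E → Matrix α α ℂ}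
    (hΦ : IsPolyMap Φ) : IsPolyMap fun x => (Φ x).adjugate := by
  refine IsPolyMap.of_entry fun i j => ?_
  simp only [Matrix.adjugate_apply]
  refine IsPolyMap.det (IsPolyMap.of_entry fun k l => ?_)
  simp only [Matrix.updateRow_apply]
  split_ifs
  · exact const_mem_polyFun _
  · exact hΦ.entry k l

theorem IsPolyMap.list_prod [Fintype α] [DecidableEq α] {σ : Type*} (s : List σ)
    {Φ : σ → E → Matrix α α ℂ} (hΦ : ∀ i, IsPolyMap (Φ i)) :
    IsPolyMap fun x => (s.map fun i => Φ i x).prod := by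
  induction s with
  | nil => simpa using! IsPolyMap.const (E := E) (1 : Matrix α α ℂ)
  | cons a s ih => simpa using! (hΦ a).matrix_mul ih

/-- If `L x : V → W` depends polynomially on `x`, so does its matrix after composition with fixed
linear maps. -/
theorem IsPolyMap.toMatrix' {r : ℕ} {L : E → V →ₗ[ℂ] W} (hL : ∀ v, IsPolyMap fun x => L x v)
    (τ : (Fin r → ℂ) →ₗ[ℂ] V) (ρ : W →ₗ[ℂ] (Fin r → ℂ)) :
    IsPolyMap fun x => LinearMap.toMatrix' (ρ ∘ₗ L x ∘ₗ τ) := by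
  refine IsPolyMap.of_entry fun i j => ?_
  simp only [LinearMap.toMatrix'_apply, LinearMap.comp_apply]
  exact ((hL _).linear_comp ρ).apply i

/-- A linear map is an isomorphism between a complement of its kernel and a quotient of its
target. -/
theorem exists_slice [FiniteDimensional ℂ V] (T : V →ₗ[ℂ] W) :
    ∃ (r : ℕ) (τ : (Fin r → ℂ) →ₗ[ℂ] V) (ρ : W →ₗ[ℂ] (Fin r → ℂ)),
      r + Module.finrank ℂ (LinearMap.ker T) = Module.finrank ℂ V ∧
      IsCompl (LinearMap.ker T) (LinearMap.range τ) ∧ ρ ∘ₗ T ∘ₗ τ = LinearMap.id := by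
  obtain ⟨U, hU⟩ := Submodule.exists_isCompl (LinearMap.ker T)
  let b := Module.finBasis ℂ U
  let τ : (Fin (Module.finrank ℂ U) → ℂ) →ₗ[ℂ] V := U.subtype ∘ₗ b.equivFun.symm.toLinearMap
  have hτ : LinearMap.range τ = U := by
    rw [LinearMap.range_comp_of_range_eq_top _ (LinearEquiv.range _), Submodule.range_subtype]
  have hker : LinearMap.ker (T ∘ₗ τ) = ⊥ := by
    rw [LinearMap.ker_eq_bot']
    intro s hs
    have h1 : τ s ∈ LinearMap.ker T ⊓ U := ⟨hs, hτ.le (LinearMap.mem_range_self τ s)⟩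
    rw [hU.inf_eq_bot, Submodule.mem_bot] at h1
    exact b.equivFun.symm.map_eq_zero_iff.1 (Subtype.ext h1)
  obtain ⟨ρ, hρ⟩ := LinearMap.exists_leftInverse_of_injective _ hker
  refine ⟨_, τ, ρ, ?_, by rwa [hτ], hρ⟩
  rw [add_comm]
  exact Submodule.finrank_add_eq_of_isCompl hU

end

/-! ### Smoothness from local equations on a vector space -/

theorem MvPolynomial.hasDerivAt_eval_add_smul {ι : Type*} [Fintype ι] (f : MvPolynomial ι ℂ)
    (x v : ι → ℂ) :
    HasDerivAt (fun t : ℂ => eval (x + t • v) f) (∑ k, v k * eval x (pderiv k f)) 0 := by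
  classical
  induction f using MvPolynomial.induction_on with
  | C a => simpa using! hasDerivAt_const (0 : ℂ) a
  | add p q hp hq =>
    simp only [map_add, mul_add, Finset.sum_add_distrib]
    exact hp.add hq
  | mul_X p i hp =>
    have h1 : HasDerivAt (fun t : ℂ => x i + t * v i) (v i) 0 := by
      simpa using! ((hasDerivAt_id (0 : ℂ)).mul_const (v i)).const_add (x i)
    convert! hp.mul h1 using 1
    · ext t; simp
    · simp only [Derivation.leibniz, pderiv_X, smul_eq_mul, map_add, map_mul, eval_X, mul_add,
        Finset.sum_add_distrib, zero_mul, add_zero, zero_smul]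
      rw [add_comm]
      congr 1
      · rw [Finset.sum_mul]
        exact Finset.sum_congr rfl fun k _ => by ring
      · rw [Finset.sum_eq_single i]
        · simp [mul_comm]
        · intro k _ hk
          simp [Pi.single_eq_of_ne hk.symm]
        · simp

/-- Local polynomial equations with linearly independent differentials exhibit smoothness. -/
theorem isSmoothOfDimAt_of_equations {ι : Type} [Fintype ι] {E κ : Type*} [AddCommGroup E]
    [Module ℂ E] [Fintype κ] (e : E ≃ₗ[ℂ] (ι → ℂ)) {S : Set E} {x : E} {d : ℕ}
    (hd : Fintype.card κ + d = Fintype.card ι) {F : κ → E → ℂ} {g : E → ℂ}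
    (hF : ∀ i, F i ∈ polyFun E) (hg : g ∈ polyFun E) (hgx : g x ≠ 0)
    (hS : ∀ y, g y ≠ 0 → (y ∈ S ↔ ∀ i, F i y = 0)) {l : κ → Module.Dual ℂ E}
    (hl : ∀ i v, HasDerivAt (fun t : ℂ => F i (x + t • v)) (l i v) 0)
    (hli : LinearIndependent ℂ l) : IsSmoothOfDimAt (e '' S) d (e x) := by
  classical
  choose f hf using fun i => exists_mvPolynomial_of_mem_polyFun (hF i) e
  obtain ⟨G, hG⟩ := exists_mvPolynomial_of_mem_polyFun hg e
  let σ := Fintype.equivFin κ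
  refine ⟨Fintype.card κ, fun i => f (σ.symm i), G, hd, by rwa [hG], ?_, ?_⟩
  · intro y hy
    obtain ⟨y, rfl⟩ := e.surjective y
    rw [hG] at hy
    rw [e.injective.mem_set_image, hS y hy, ← σ.symm.forall_congr_right]
    simp only [hf]
  · have hpd : ∀ i k, MvPolynomial.eval (e x) (MvPolynomial.pderiv k (f i)) =
        l i (e.symm (Pi.single k 1)) := by
      intro i k
      have h1 := MvPolynomial.hasDerivAt_eval_add_smul (f i) (e x) (Pi.single k 1)
      have h2 := hl i (e.symm (Pi.single k 1))
      have h3 : (fun t : ℂ => MvPolynomial.eval (e x + t • (Pi.single k 1 : ι → ℂ)) (f i)) =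
          fun t => F i (x + t • e.symm (Pi.single k 1)) := by
        ext t
        rw [← hf]
        simp
      rw [h3] at h1
      have h4 := h1.unique h2
      rw [← h4, Finset.sum_eq_single k] <;> simp +contextual
    let T : Module.Dual ℂ E →ₗ[ℂ] (ι → ℂ) :=
      LinearMap.pi fun k => LinearMap.applyₗ (e.symm (Pi.single k 1))
    have hT : LinearMap.ker T = ⊥ := by
      rw [LinearMap.ker_eq_bot']
      intro m hm
      have hm' : ∀ k, m (e.symm (Pi.single k 1)) = 0 := fun k => congrFun hm k
      ext y
      have h : y = e.symm (∑ k, e y k • Pi.single k 1) := by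
        rw [← pi_eq_sum_univ', e.symm_apply_apply]
      rw [h]
      simp [hm']
    have := (hli.map' T hT).comp σ.symm σ.symm.injective
    convert! this using 1
    ext i k
    exact hpd _ _

/-! ### Local equations of a conjugacy class -/

/-- The linear map `P ↦ M P - P B`. -/
def sylvester {n : ℕ} (M B : Matrix (Fin n) (Fin n) ℂ) :
    Matrix (Fin n) (Fin n) ℂ →ₗ[ℂ] Matrix (Fin n) (Fin n) ℂ :=
  LinearMap.mulLeft ℂ M - LinearMap.mulRight ℂ B

section

variable {n : ℕ} {M B : Matrix (Fin n) (Fin n) ℂ}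

theorem sylvester_apply (M B P : Matrix (Fin n) (Fin n) ℂ) :
    sylvester M B P = M * P - P * B := rfl

theorem finrank_le_finrank_of_injective_of_mapsTo {V W : Type*} [AddCommGroup V] [Module ℂ V]
    [AddCommGroup W] [Module ℂ W] [FiniteDimensional ℂ W] (T : V →ₗ[ℂ] W)
    (hT : Function.Injective T) {p : Submodule ℂ V} {q : Submodule ℂ W}
    (h : ∀ v ∈ p, T v ∈ q) : Module.finrank ℂ p ≤ Module.finrank ℂ q :=
  LinearMap.finrank_le_finrank_of_injective (f := T.restrict h)
    fun _ _ hab => Subtype.ext (hT (congrArg Subtype.val hab))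

/-- If `c B = M c`, left multiplication by `c` sends the centralizer of `B` injectively into the
solutions of `M P = P B`. -/
theorem finrank_ker_sylvester_le_of_isConj (h : IsConj M B) :
    Module.finrank ℂ (LinearMap.ker (sylvester B B)) ≤
      Module.finrank ℂ (LinearMap.ker (sylvester M B)) := by
  obtain ⟨c, hc⟩ := h.symm
  refine finrank_le_finrank_of_injective_of_mapsTo
    (LinearMap.mulLeft ℂ (c : Matrix (Fin n) (Fin n) ℂ))
    (fun a b hab => c.mul_right_inj.1 hab) fun P hP => ?_
  rw [LinearMap.mem_ker, sylvester_apply, sub_eq_zero] at hP ⊢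
  rw [LinearMap.mulLeft_apply, ← mul_assoc, ← hc.eq, mul_assoc, hP, mul_assoc]

theorem finrank_ker_sylvester_self_le_of_isConj (h : IsConj M B) :
    Module.finrank ℂ (LinearMap.ker (sylvester B B)) ≤
      Module.finrank ℂ (LinearMap.ker (sylvester M M)) := by
  obtain ⟨c, hc⟩ := h.symm
  refine finrank_le_finrank_of_injective_of_mapsTo
    (LinearMap.mulLeft ℂ (c : Matrix (Fin n) (Fin n) ℂ) ∘ₗ
      LinearMap.mulRight ℂ ((c⁻¹ : (Matrix (Fin n) (Fin n) ℂ)ˣ) : Matrix (Fin n) (Fin n) ℂ))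
    (fun a b hab => (c⁻¹).mul_left_inj.1 (c.mul_right_inj.1 hab)) fun P hP => ?_
  rw [LinearMap.mem_ker, sylvester_apply, sub_eq_zero] at hP ⊢
  have hc2 : ((c⁻¹ : (Matrix (Fin n) (Fin n) ℂ)ˣ) : Matrix (Fin n) (Fin n) ℂ) * M =
      B * ((c⁻¹ : (Matrix (Fin n) (Fin n) ℂ)ˣ) : Matrix (Fin n) (Fin n) ℂ) :=
    (hc.units_inv_symm_left).eq
  simp only [LinearMap.comp_apply, LinearMap.mulLeft_apply, LinearMap.mulRight_apply]
  rw [← mul_assoc, ← hc.eq, mul_assoc, ← mul_assoc B, hP, mul_assoc P, ← hc2, mul_assoc, mul_assoc]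

theorem finrank_ker_sylvester_self_eq_of_isConj (h : IsConj M B) :
    Module.finrank ℂ (LinearMap.ker (sylvester M M)) =
      Module.finrank ℂ (LinearMap.ker (sylvester B B)) :=
  le_antisymm (finrank_ker_sylvester_self_le_of_isConj h.symm)
    (finrank_ker_sylvester_self_le_of_isConj h)

/-- Linear forms cutting out the image of a linear endomorphism. -/
theorem exists_linear_equations_range {V : Type*} [AddCommGroup V] [Module ℂ V]
    [FiniteDimensional ℂ V] (T : V →ₗ[ℂ] V) :
    ∃ l : Fin (Module.finrank ℂ (LinearMap.ker T)) → Module.Dual ℂ V,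
      LinearIndependent ℂ l ∧ ∀ v, v ∈ LinearMap.range T ↔ ∀ i, l i v = 0 := by
  have hd : Module.finrank ℂ (LinearMap.range T).dualAnnihilator =
      Module.finrank ℂ (LinearMap.ker T) := by
    have h1 := Subspace.finrank_add_finrank_dualAnnihilator_eq (LinearMap.range T)
    have h2 := T.finrank_range_add_finrank_ker
    omega
  let b := Module.finBasisOfFinrankEq ℂ (LinearMap.range T).dualAnnihilator hd
  have hb := b.linearIndependent.map' (LinearMap.range T).dualAnnihilator.subtype
    (Submodule.ker_subtype _)
  refine ⟨fun i => (b i : Module.Dual ℂ V), hb, fun v => ?_⟩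
  rw [← Subspace.forall_mem_dualAnnihilator_apply_eq_zero_iff]
  constructor
  · intro h i
    exact h _ (b i).2
  · intro h φ hφ
    have h1 := congrArg (fun ψ : (LinearMap.range T).dualAnnihilator => (ψ : Module.Dual ℂ V) v)
      (b.sum_repr ⟨φ, hφ⟩)
    simp only [Submodule.coe_sum, Submodule.coe_smul, LinearMap.sum_apply, LinearMap.smul_apply,
      h, smul_zero, Finset.sum_const_zero] at h1
    exact h1.symm

/-- Near `B`, the conjugacy class of `B` is cut out by `dim Z(B)` polynomial equations whose
differentials at `B` are linearly independent and vanish on the tangent space `[B, gl(n)]`. -/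
theorem exists_conj_equations (B : Matrix (Fin n) (Fin n) ℂ) :
    ∃ (F : Fin (Module.finrank ℂ (LinearMap.ker (sylvester B B))) → Matrix (Fin n) (Fin n) ℂ → ℂ)
      (g : Matrix (Fin n) (Fin n) ℂ → ℂ)
      (l : Fin (Module.finrank ℂ (LinearMap.ker (sylvester B B))) →
        Module.Dual ℂ (Matrix (Fin n) (Fin n) ℂ)),
      (∀ i, F i ∈ polyFun (Matrix (Fin n) (Fin n) ℂ)) ∧
      g ∈ polyFun (Matrix (Fin n) (Fin n) ℂ) ∧ g B ≠ 0 ∧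
      (∀ M, g M ≠ 0 → (IsConj M B ↔ ∀ i, F i M = 0)) ∧
      (∀ i X, HasDerivAt (fun t : ℂ => F i (B + t • X)) (l i X) 0) ∧
      LinearIndependent ℂ l ∧ ∀ i Y, l i (B * Y - Y * B) = 0 := by
  obtain ⟨r, τ, ρ, hr, hcompl, hρ⟩ := exists_slice (sylvester B B)
  obtain ⟨l, hl, hlr⟩ := exists_linear_equations_range (sylvester B B)
  let W : Matrix (Fin n) (Fin n) ℂ → Matrix (Fin r) (Fin r) ℂ := fun M =>
    LinearMap.toMatrix' (ρ ∘ₗ sylvester M B ∘ₗ τ)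
  -- Cramer's rule: up to the factor `det (W M)`, this corrects `1` by an element of the range of
  -- `τ` so that `M P - P B` is killed by `ρ`. The adjugate keeps it polynomial in `M`.
  let Q : Matrix (Fin n) (Fin n) ℂ → Matrix (Fin n) (Fin n) ℂ := fun M =>
    (W M).det • 1 - τ ((W M).adjugate.mulVec (ρ (sylvester M B 1)))
  have hsyl : ∀ P, IsPolyMap fun M => sylvester M B P := fun P =>
    (IsPolyMap.linear (LinearMap.mulRight ℂ P)).sub (IsPolyMap.const (P * B))
  have hW : IsPolyMap W := IsPolyMap.toMatrix' hsyl τ ρ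
  have hQ : IsPolyMap Q := (IsPolyMap.smul hW.det (IsPolyMap.const 1)).sub
    ((hW.adjugate.mulVec ((hsyl 1).linear_comp ρ)).linear_comp τ)
  have hWmul : ∀ M s, (W M).mulVec s = ρ (sylvester M B (τ s)) := fun M s => by
    rw [← Matrix.toLin'_apply, Matrix.toLin'_toMatrix']; rfl
  have hρs : ∀ s, ρ (sylvester B B (τ s)) = s := fun s => LinearMap.congr_fun hρ s
  have hτinj : Function.Injective τ := fun a b hab => by rw [← hρs a, hab, hρs b]
  have hsB1 : sylvester B B 1 = 0 := by simp [sylvester_apply]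
  have hWB : W B = 1 := by
    change LinearMap.toMatrix' (ρ ∘ₗ sylvester B B ∘ₗ τ) = 1
    rw [hρ, LinearMap.toMatrix'_id]
  have hQB : Q B = 1 := by
    change (W B).det • 1 - τ ((W B).adjugate.mulVec (ρ (sylvester B B 1))) = 1
    rw [hWB, hsB1]
    simp
  have hρQ : ∀ M, ρ (sylvester M B (Q M)) = 0 := fun M => by
    change ρ (sylvester M B ((W M).det • 1 - τ ((W M).adjugate.mulVec (ρ (sylvester M B 1))))) = 0
    rw [map_sub, map_sub, map_smul, map_smul, ← hWmul, Matrix.mulVec_mulVec,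
      Matrix.mul_adjugate, Matrix.smul_mulVec, Matrix.one_mulVec, sub_self]
  -- The forms `l i` place `Y` in the range of `sylvester B B`, on which `ρ` is injective. So once
  -- `ρ` is annihilated, the `l i` alone decide whether `Q M` solves the system.
  have hzero : ∀ Y, ρ Y = 0 → (∀ i, l i Y = 0) → Y = 0 := by
    intro Y hY hi
    obtain ⟨P, rfl⟩ := (hlr Y).2 hi
    have hP : P ∈ LinearMap.ker (sylvester B B) ⊔ LinearMap.range τ := by
      rw [hcompl.sup_eq_top]; trivial
    obtain ⟨k, hk, _, ⟨s, rfl⟩, rfl⟩ := Submodule.mem_sup.1 hP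
    rw [map_add, LinearMap.mem_ker.1 hk, zero_add] at hY ⊢
    rw [hρs] at hY
    rw [hY, map_zero, map_zero]
  refine ⟨fun i M => l i (sylvester M B (Q M)), fun M => (W M).det * (Q M).det, l, ?_,
    mul_mem_polyFun hW.det hQ.det, ?_, ?_, ?_, hl, fun i Y => (hlr _).1 ⟨Y, rfl⟩ i⟩
  · intro i
    exact ((IsPolyMap.linear LinearMap.id).matrix_mul hQ).sub
      (hQ.linear_comp (LinearMap.mulRight ℂ B)) (l i)
  · simp [hWB, hQB]
  · intro M hM
    have hWM : (W M).det ≠ 0 := left_ne_zero_of_mul hM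
    have hQM : (Q M).det ≠ 0 := right_ne_zero_of_mul hM
    constructor
    · intro hconj i
      -- When `M` is conjugate to `B`, the solution space is large enough to be a complement of the
      -- range of `τ`. Then `1 = k + τ s` with `k` a solution, and `Q M` is a multiple of `k`.
      have hdisj : Disjoint (LinearMap.ker (sylvester M B)) (LinearMap.range τ) := by
        rw [Submodule.disjoint_def]
        rintro _ hk ⟨s, rfl⟩
        have h1 : (W M).mulVec s = 0 := by
          rw [hWmul, LinearMap.mem_ker.1 hk, map_zero]
        rw [Matrix.eq_zero_of_mulVec_eq_zero hWM h1, map_zero]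
      have htop : LinearMap.ker (sylvester M B) ⊔ LinearMap.range τ = ⊤ := by
        refine Submodule.eq_top_of_disjoint _ _ ?_ hdisj
        rw [LinearMap.finrank_range_of_inj hτinj, Module.finrank_fin_fun, ← hr, add_comm]
        exact Nat.add_le_add_right (finrank_ker_sylvester_le_of_isConj hconj) _
      have h1 : (1 : Matrix (Fin n) (Fin n) ℂ) ∈
          LinearMap.ker (sylvester M B) ⊔ LinearMap.range τ := by rw [htop]; trivial
      obtain ⟨k, hk, _, ⟨s, rfl⟩, hks⟩ := Submodule.mem_sup.1 h1
      have h2 : Q M = (W M).det • k := by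
        have h3 : ρ (sylvester M B 1) = (W M).mulVec s := by
          rw [← hks, map_add, LinearMap.mem_ker.1 hk, zero_add, hWmul]
        change (W M).det • 1 - τ ((W M).adjugate.mulVec (ρ (sylvester M B 1))) = _
        rw [h3, Matrix.mulVec_mulVec, Matrix.adjugate_mul, Matrix.smul_mulVec,
          Matrix.one_mulVec, map_smul, ← smul_sub, ← hks, add_sub_cancel_right]
      simp only [h2, map_smul, LinearMap.mem_ker.1 hk, map_zero, smul_zero]
    · intro hF
      have h1 := hzero _ (hρQ M) hF
      rw [sylvester_apply, sub_eq_zero] at h1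
      have hu : IsUnit (Q M) := (Matrix.isUnit_iff_isUnit_det _).2 hQM.isUnit
      exact IsConj.symm ⟨hu.unit, h1.symm⟩
  · intro i X
    obtain ⟨m, hm⟩ := exists_hasDerivAt_of_mem_polyFun
      (hQ ((l i) ∘ₗ LinearMap.mulLeft ℂ X)) B
    have h1 := (hasDerivAt_id (0 : ℂ)).mul (hm X)
    -- Since `l i` kills the range of `sylvester B B`, a factor `t` splits off; at `t = 0` the
    -- derivative only sees `Q B = 1`.
    have h2 : (fun t : ℂ => l i (sylvester (B + t • X) B (Q (B + t • X)))) =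
        fun t => t * l i (X * Q (B + t • X)) := by
      ext t
      have h3 : sylvester (B + t • X) B (Q (B + t • X)) =
          t • (X * Q (B + t • X)) + sylvester B B (Q (B + t • X)) := by
        simp only [sylvester_apply, add_mul, Matrix.smul_mul]
        abel
      rw [h3, map_add, (hlr (sylvester B B _)).1 ⟨_, rfl⟩ i, add_zero, map_smul, smul_eq_mul]
    rw [h2]
    convert! h1 using 1
    simp [hQB]

/-- The smooth structure of a conjugacy class and its dimension. -/
theorem classDim_setOf_isConj (B : Matrix (Fin n) (Fin n) ℂ) :
    classDim {M | IsConj M B} + Module.finrank ℂ (LinearMap.ker (sylvester B B)) = n ^ 2 := by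
  let e : Matrix (Fin n) (Fin n) ℂ ≃ₗ[ℂ] (Fin n × Fin n → ℂ) :=
    (LinearEquiv.curry ℂ ℂ (Fin n) (Fin n)).symm
  have hle : Module.finrank ℂ (LinearMap.ker (sylvester B B)) ≤ n ^ 2 := by
    refine (Submodule.finrank_le _).trans ?_
    simp [Module.finrank_matrix, pow_two]
  obtain ⟨d, hd⟩ := Nat.exists_eq_add_of_le hle
  have hsm : IsSmoothVariety (matrixPoints {M | IsConj M B}) d := by
    rintro _ ⟨A, hA, rfl⟩
    -- The equations are centred at the point `A`, not at `B`; conjugate matrices have centralizers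
    -- of equal dimension, so the codimension is the same.
    obtain ⟨F, g, l, hF, hg, hgA, hS, hder, hli, -⟩ := exists_conj_equations A
    refine isSmoothOfDimAt_of_equations e (x := A) ?_ hF hg hgA (fun y hy => ?_) hder hli
    · rw [finrank_ker_sylvester_self_eq_of_isConj hA]
      simp [← hd, pow_two]
    · rw [← hS y hy]
      exact ⟨fun h => h.trans (IsConj.symm hA), fun h => h.trans hA⟩
  have hdim := hsm.varietyDim_eq (Set.Nonempty.image _ ⟨B, IsConj.refl B⟩)
  have : classDim {M | IsConj M B} = d := by
    rw [classDim, hdim]; rfl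
  omega

end

section

variable {m n : ℕ}

/-- Tuples of matrices as points of the affine space of their entries. -/
def tupleEquiv (m n : ℕ) :
    (Fin m → Matrix (Fin n) (Fin n) ℂ) ≃ₗ[ℂ] (Fin m × Fin n × Fin n → ℂ) where
  toFun A k := A k.1 k.2.1 k.2.2
  invFun x j a b := x (j, a, b)
  map_add' _ _ := rfl
  map_smul' _ _ := rfl
  left_inv _ := rfl
  right_inv _ := rfl

/-! ### Trivial centralizer is an open condition -/

theorem hasTrivialCentralizer_iff (A : Fin m → Matrix (Fin n) (Fin n) ℂ) :
    HasTrivialCentralizer A ↔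
      ∀ Y, (∀ j, A j * Y = Y * A j) → Y ∈ Submodule.span ℂ {(1 : Matrix (Fin n) (Fin n) ℂ)} := by
  rw [HasTrivialCentralizer, eq_bot_iff]
  constructor
  · intro h Y hY
    obtain ⟨a, rfl⟩ := Algebra.mem_bot.1 (h (Subalgebra.mem_centralizer_iff ℂ |>.2 (by
      rintro _ ⟨j, rfl⟩
      exact hY j)))
    exact Submodule.mem_span_singleton.2 ⟨a, (Algebra.algebraMap_eq_smul_one a).symm⟩
  · intro h Y hY
    obtain ⟨a, rfl⟩ := Submodule.mem_span_singleton.1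
      (h Y fun j => (Subalgebra.mem_centralizer_iff ℂ).1 hY _ ⟨j, rfl⟩)
    exact Algebra.mem_bot.2 ⟨a, Algebra.algebraMap_eq_smul_one a⟩

/-- Scalars always lie in the kernel of `Y ↦ ([A_j, Y])_j`. Having no further kernel means
injectivity on a complement of the scalars, which nonvanishing of a minor guarantees. -/
theorem exists_polyFun_hasTrivialCentralizer {A : Fin m → Matrix (Fin n) (Fin n) ℂ}
    (hA : HasTrivialCentralizer A) :
    ∃ g ∈ polyFun (Fin m → Matrix (Fin n) (Fin n) ℂ), g A ≠ 0 ∧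
      ∀ A', g A' ≠ 0 → HasTrivialCentralizer A' := by
  let L : (Fin m → Matrix (Fin n) (Fin n) ℂ) →
      Matrix (Fin n) (Fin n) ℂ →ₗ[ℂ] (Fin m → Matrix (Fin n) (Fin n) ℂ) := fun A =>
    LinearMap.pi fun j => sylvester (A j) (A j)
  have hL : ∀ Y, IsPolyMap fun A => L A Y := fun Y =>
    IsPolyMap.linear (LinearMap.pi fun j =>
      (LinearMap.mulRight ℂ Y - LinearMap.mulLeft ℂ Y) ∘ₗ LinearMap.proj j)
  have hker : ∀ A' Y, Y ∈ LinearMap.ker (L A') ↔ ∀ j, A' j * Y = Y * A' j := by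
    intro A' Y
    rw [LinearMap.mem_ker, funext_iff]
    exact forall_congr' fun j => sub_eq_zero
  obtain ⟨r, τ, ρ, -, hcompl, hρ⟩ := exists_slice (L A)
  refine ⟨fun A' => (LinearMap.toMatrix' (ρ ∘ₗ L A' ∘ₗ τ)).det,
    (IsPolyMap.toMatrix' hL τ ρ).det, ?_, ?_⟩
  · change (LinearMap.toMatrix' (ρ ∘ₗ L A ∘ₗ τ)).det ≠ 0
    rw [hρ, LinearMap.toMatrix'_id, Matrix.det_one]
    exact one_ne_zero
  · intro A' hA'
    rw [hasTrivialCentralizer_iff] at hA ⊢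
    intro Y hY
    have h1 : Y ∈ LinearMap.ker (L A) ⊔ LinearMap.range τ := by rw [hcompl.sup_eq_top]; trivial
    obtain ⟨k, hk, _, ⟨s, rfl⟩, rfl⟩ := Submodule.mem_sup.1 h1
    have hk1 := hA k ((hker A k).1 hk)
    have hk2 : k ∈ LinearMap.ker (L A') := by
      obtain ⟨a, rfl⟩ := Submodule.mem_span_singleton.1 hk1
      rw [hker]
      simp
    have h2 := (hker A' _).2 hY
    rw [LinearMap.mem_ker, map_add, LinearMap.mem_ker.1 hk2, zero_add] at h2
    have h3 : s = 0 := by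
      refine Matrix.eq_zero_of_mulVec_eq_zero hA' ?_
      rw [← Matrix.toLin'_apply, Matrix.toLin'_toMatrix', LinearMap.comp_apply,
        LinearMap.comp_apply, h2, map_zero]
    rw [h3, map_zero, add_zero]
    exact hk1

/-! ### Tuples in given conjugacy classes subject to a matrix equation -/

/-- Tuples in the conjugacy classes of `B j` with trivial centralizer and `Φ = T`. -/
def relationTuples (B : Fin m → Matrix (Fin n) (Fin n) ℂ)
    (Φ : (Fin m → Matrix (Fin n) (Fin n) ℂ) → Matrix (Fin n) (Fin n) ℂ)
    (T : Matrix (Fin n) (Fin n) ℂ) : Set (Fin m → Matrix (Fin n) (Fin n) ℂ) :=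
  {A | (∀ j, IsConj (A j) (B j)) ∧ Φ A = T ∧ HasTrivialCentralizer A}

/-- At `A`, derivatives of `Φ` along the product of the conjugacy classes are annihilated, for the
trace form, only by matrices commuting with all `A j`. -/
def IsTransverseAt (Φ : (Fin m → Matrix (Fin n) (Fin n) ℂ) → Matrix (Fin n) (Fin n) ℂ)
    (A : Fin m → Matrix (Fin n) (Fin n) ℂ) : Prop :=
  ∃ D : Fin m → Matrix (Fin n) (Fin n) ℂ → Matrix (Fin n) (Fin n) ℂ,
    (∀ j Y (t : ℂ),
      Φ (A + t • Pi.single (M := fun _ => Matrix (Fin n) (Fin n) ℂ) j (A j * Y - Y * A j)) =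
        Φ A + t • D j Y) ∧
    ∀ β, (∀ j Y, (β * D j Y).trace = 0) → ∀ j, A j * β = β * A j

/-- The coefficients of the entries of `Φ` in a relation form a matrix `β`, which `hD` and the
trivial centralizer force to be scalar; the omitted position makes it zero. What remains is a
relation within each class separately. -/
theorem linearIndependent_differentials {A : Fin m → Matrix (Fin n) (Fin n) ℂ}
    (hA : HasTrivialCentralizer A) (i₀ : Fin n) {σ : Fin m → Type*} [∀ j, Fintype (σ j)]
    (l : ∀ j, σ j → Module.Dual ℂ (Matrix (Fin n) (Fin n) ℂ))
    (hli : ∀ j, LinearIndependent ℂ (l j))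
    (hl : ∀ j i Y, l j i (A j * Y - Y * A j) = 0)
    (μ : Fin n → Fin n → Module.Dual ℂ (Fin m → Matrix (Fin n) (Fin n) ℂ))
    {D : Fin m → Matrix (Fin n) (Fin n) ℂ → Matrix (Fin n) (Fin n) ℂ}
    (hμ : ∀ a b j Y, μ a b (Pi.single j (A j * Y - Y * A j)) = D j Y a b)
    (hD : ∀ β, (∀ j Y, (β * D j Y).trace = 0) → ∀ j, A j * β = β * A j) :
    LinearIndependent ℂ (Sum.elim
      (fun s : Σ j, σ j => l s.1 s.2 ∘ₗ LinearMap.proj (R := ℂ) s.1)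
      (fun k : {k : Fin n × Fin n // k ≠ (i₀, i₀)} => μ k.1.1 k.1.2)) := by
  classical
  rw [Fintype.linearIndependent_iff]
  intro w hw
  simp only [Fintype.sum_sum_type, Sum.elim_inl, Sum.elim_inr] at hw
  -- The indices are transposed so that `trace (β * X)` is the combination of the entries of `X`;
  -- the omitted coefficient is set to `0`.
  let β : Matrix (Fin n) (Fin n) ℂ := Matrix.of fun b a =>
    if h : (a, b) ≠ (i₀, i₀) then w (Sum.inr ⟨(a, b), h⟩) else 0
  have hβw : ∀ k : {k : Fin n × Fin n // k ≠ (i₀, i₀)}, β k.1.2 k.1.1 = w (Sum.inr k) := fun k =>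
    dif_pos k.2
  have hβ₀ : β i₀ i₀ = 0 := by simp [β]
  have hβ : ∀ X : Matrix (Fin n) (Fin n) ℂ, (β * X).trace =
      ∑ k : {k : Fin n × Fin n // k ≠ (i₀, i₀)}, w (Sum.inr k) * X k.1.1 k.1.2 := by
    intro X
    have h1 : (β * X).trace = ∑ k : Fin n × Fin n, β k.2 k.1 * X k.1 k.2 := by
      simp only [Matrix.trace, Matrix.diag_apply, Matrix.mul_apply]
      rw [Fintype.sum_prod_type, Finset.sum_comm]
    rw [h1, Fintype.sum_eq_add_sum_subtype_ne _ (i₀, i₀), hβ₀, zero_mul, zero_add]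
    exact Finset.sum_congr rfl fun k _ => by rw [hβw]
  -- Evaluating the relation at `[A_j, Y]` in slot `j` removes every class differential.
  have hcomm := hD β fun j Y => by
    rw [hβ]
    have h1 := LinearMap.congr_fun hw (Pi.single j (A j * Y - Y * A j))
    have h2 : ∀ s : Σ j, σ j, l s.1 s.2
        ((Pi.single j (A j * Y - Y * A j) : Fin m → Matrix (Fin n) (Fin n) ℂ) s.1) = 0 := by
      rintro ⟨j', i⟩
      by_cases hj : j' = j
      · subst hj
        simpa using hl j' i Y
      · simp [Pi.single_eq_of_ne hj]
    simpa [h2, hμ] using h1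
  have hβ0 : β = 0 := by
    obtain ⟨a, ha⟩ := Submodule.mem_span_singleton.1
      ((hasTrivialCentralizer_iff A).1 hA β hcomm)
    rw [← ha] at hβ₀ ⊢
    have h2 : a = 0 := by simpa using hβ₀
    rw [h2, zero_smul]
  have hw2 : ∀ k, w (Sum.inr k) = 0 := by
    intro k
    rw [← hβw k, hβ0]
    rfl
  have hw1 : ∀ j i, w (Sum.inl ⟨j, i⟩) = 0 := by
    intro j
    refine Fintype.linearIndependent_iff.1 (hli j) _ ?_
    ext X
    have h1 := LinearMap.congr_fun hw (LinearMap.single ℂ _ j X)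
    simp only [hw2, zero_smul, Finset.sum_const_zero, add_zero, Fintype.sum_sigma,
      LinearMap.sum_apply, LinearMap.smul_apply, LinearMap.comp_apply, LinearMap.proj_apply,
      LinearMap.zero_apply] at h1
    rw [Finset.sum_eq_single j] at h1
    · simpa using h1
    · intro j' _ hj
      simp [Pi.single_eq_of_ne hj]
    · simp
  rintro (⟨j, i⟩ | k)
  · exact hw1 j i
  · exact hw2 k

/-- Hypothesis `hT` allows the `(i₀, i₀)` entry to be left out of the equations. The first
conclusion, that independent differentials cannot outnumber the coordinates, makes `d` a natural
number. -/
theorem relationTuples_isSmoothOfDimAt (i₀ : Fin n) {B : Fin m → Matrix (Fin n) (Fin n) ℂ}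
    {Φ : (Fin m → Matrix (Fin n) (Fin n) ℂ) → Matrix (Fin n) (Fin n) ℂ} (hΦ : IsPolyMap Φ)
    {T : Matrix (Fin n) (Fin n) ℂ}
    (hT : ∀ A, (∀ j, IsConj (A j) (B j)) →
      (∀ a b, (a, b) ≠ (i₀, i₀) → Φ A a b = T a b) → Φ A = T)
    {A : Fin m → Matrix (Fin n) (Fin n) ℂ} (hA : A ∈ relationTuples B Φ T)
    (htr : IsTransverseAt Φ A) :
    ∑ j, Module.finrank ℂ (LinearMap.ker (sylvester (B j) (B j))) + (n ^ 2 - 1) ≤ m * n ^ 2 ∧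
    ∀ d : ℕ, ∑ j, Module.finrank ℂ (LinearMap.ker (sylvester (B j) (B j))) + (n ^ 2 - 1) + d =
        m * n ^ 2 →
      IsSmoothOfDimAt (tuplePoints (relationTuples B Φ T)) d (tupleEquiv m n A) := by
  classical
  obtain ⟨hAB, hAT, hAc⟩ := hA
  obtain ⟨D, hD, hDβ⟩ := htr
  choose F g l hF hg hgA hS hder hli hl using fun j => exists_conj_equations (A j)
  obtain ⟨g₀, hg₀, hg₀A, hg₀c⟩ := exists_polyFun_hasTrivialCentralizer hAc
  choose μ hμ using fun a b => exists_hasDerivAt_of_mem_polyFun (hΦ.entry a b) A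
  have hμD : ∀ a b j Y, μ a b (Pi.single j (A j * Y - Y * A j)) = D j Y a b := by
    intro a b j Y
    have h1 := hμ a b (Pi.single j (A j * Y - Y * A j))
    simp only [hD] at h1
    have h2 : HasDerivAt (fun t : ℂ => (Φ A + t • D j Y) a b) (D j Y a b) 0 := by
      simpa using! ((hasDerivAt_id (0 : ℂ)).mul_const (D j Y a b)).const_add (Φ A a b)
    exact h1.unique h2
  have hind := linearIndependent_differentials hAc i₀ l hli hl μ hμD hDβ
  have hcard : Fintype.card ((Σ j, Fin (Module.finrank ℂ (LinearMap.ker (sylvester (A j) (A j))))) ⊕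
      {k : Fin n × Fin n // k ≠ (i₀, i₀)}) =
      ∑ j, Module.finrank ℂ (LinearMap.ker (sylvester (B j) (B j))) + (n ^ 2 - 1) := by
    rw [Fintype.card_sum, Fintype.card_sigma, Fintype.card_subtype_compl]
    simp [fun j => finrank_ker_sylvester_self_eq_of_isConj (hAB j), pow_two]
  constructor
  · rw [← hcard]
    refine hind.fintype_card_le_finrank.trans ?_
    rw [Subspace.dual_finrank_eq, (tupleEquiv m n).finrank_eq]
    simp [pow_two]
  · intro d hd
    refine isSmoothOfDimAt_of_equations (tupleEquiv m n) (x := A)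
      (κ := (Σ j, Fin (Module.finrank ℂ (LinearMap.ker (sylvester (A j) (A j))))) ⊕
        {k : Fin n × Fin n // k ≠ (i₀, i₀)})
      (F := Sum.elim (fun s X => F s.1 s.2 (X s.1)) fun k X => Φ X k.1.1 k.1.2 - T k.1.1 k.1.2)
      (g := fun X => g₀ X * ∏ j, g j (X j)) ?_ ?_ ?_ ?_ ?_ ?_ hind
    · rw [hcard, hd]
      simp [pow_two]
    · rintro (⟨j, i⟩ | k)
      · exact comp_linear_mem_polyFun (hF j i)
          (LinearMap.proj (φ := fun _ : Fin m => Matrix (Fin n) (Fin n) ℂ) j)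
      · exact sub_mem (hΦ.entry _ _) (const_mem_polyFun _)
    · exact mul_mem_polyFun hg₀
        (prod_mem_polyFun _ fun j _ => comp_linear_mem_polyFun (hg j)
          (LinearMap.proj (φ := fun _ : Fin m => Matrix (Fin n) (Fin n) ℂ) j))
    · exact mul_ne_zero hg₀A (Finset.prod_ne_zero_iff.2 fun j _ => hgA j)
    · intro X hX
      have hX0 := hg₀c X (left_ne_zero_of_mul hX)
      have hXj : ∀ j, g j (X j) ≠ 0 := fun j =>
        Finset.prod_ne_zero_iff.1 (right_ne_zero_of_mul hX) j (Finset.mem_univ j)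
      have hconj : ∀ j, IsConj (X j) (B j) ↔ ∀ i, F j i (X j) = 0 := fun j => by
        rw [← hS j _ (hXj j)]
        exact ⟨fun h => h.trans (hAB j).symm, fun h => h.trans (hAB j)⟩
      constructor
      · rintro ⟨h1, h2, -⟩ (⟨j, i⟩ | k)
        · exact (hconj j).1 (h1 j) i
        · simp [h2]
      · intro h
        have h1 : ∀ j, IsConj (X j) (B j) := fun j => (hconj j).2 fun i => h (Sum.inl ⟨j, i⟩)
        exact ⟨h1, hT X h1 fun a b hab => sub_eq_zero.1 (h (Sum.inr ⟨(a, b), hab⟩)), hX0⟩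
    · rintro (⟨j, i⟩ | k) X
      · exact hder j i (X j)
      · exact (hμ _ _ X).sub_const _

theorem relationTuples_smooth (hn : 1 ≤ n) (i₀ : Fin n) {B : Fin m → Matrix (Fin n) (Fin n) ℂ}
    {Φ : (Fin m → Matrix (Fin n) (Fin n) ℂ) → Matrix (Fin n) (Fin n) ℂ} (hΦ : IsPolyMap Φ)
    {T : Matrix (Fin n) (Fin n) ℂ}
    (hT : ∀ A, (∀ j, IsConj (A j) (B j)) →
      (∀ a b, (a, b) ≠ (i₀, i₀) → Φ A a b = T a b) → Φ A = T)
    (htr : ∀ A, Φ A = T → IsTransverseAt Φ A) (hne : (relationTuples B Φ T).Nonempty) :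
    ∃ d : ℕ, (d : ℤ) = (n : ℤ) ^ 2 + 1 - rigidityIndex (fun j => {M | IsConj M (B j)}) ∧
      IsSmoothVariety (tuplePoints (relationTuples B Φ T)) d ∧
      varietyDim (tuplePoints (relationTuples B Φ T)) = d := by
  obtain ⟨A, hA⟩ := hne
  have hpt := fun (A) (hA : A ∈ relationTuples B Φ T) =>
    relationTuples_isSmoothOfDimAt i₀ hΦ hT hA (htr A hA.2.1)
  obtain ⟨d, hd⟩ := Nat.exists_eq_add_of_le (hpt A hA).1
  have hsm : IsSmoothVariety (tuplePoints (relationTuples B Φ T)) d := by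
    rintro _ ⟨A', hA', rfl⟩
    exact (hpt A' hA').2 d hd.symm
  refine ⟨d, ?_, hsm, hsm.varietyDim_eq (Set.Nonempty.image _ ⟨A, hA⟩)⟩
  -- Summing `d_j + z_j = n²` over `j` trades centralizer dimensions for class dimensions.
  have h1 := Finset.sum_congr (rfl : (Finset.univ : Finset (Fin m)) = _)
    fun j _ => classDim_setOf_isConj (B j)
  rw [Finset.sum_add_distrib, Finset.sum_const, Finset.card_univ, Fintype.card_fin,
    smul_eq_mul] at h1
  have h2 : 1 ≤ n ^ 2 := Nat.one_le_pow _ _ hn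
  rw [rigidityIndex]
  zify [h2] at h1 hd
  linarith

end

section

variable {m n : ℕ}

/-! ### The additive and the multiplicative relation -/

/-- By cyclicity the hypothesis says that `[γ β, A]` is orthogonal to every `Y`, and the trace form
is nondegenerate. -/
theorem commute_of_trace_mul_bracket {A β γ : Matrix (Fin n) (Fin n) ℂ}
    (h : ∀ Y, (β * (A * Y - Y * A) * γ).trace = 0) : γ * β * A = A * (γ * β) := by
  have h1 : ∀ Y, ((γ * β * A - A * (γ * β)) * Y).trace = 0 := by
    intro Y
    rw [← h Y, Matrix.trace_mul_comm _ γ, mul_sub, mul_sub, sub_mul, Matrix.trace_sub,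
      Matrix.trace_sub]
    congr 1
    · simp only [mul_assoc]
    · rw [mul_assoc A, Matrix.trace_mul_comm A]
      simp only [mul_assoc]
  rw [← sub_eq_zero]
  exact Matrix.ext_iff_trace_mul_right.2 fun Y => by rw [h1, zero_mul, Matrix.trace_zero]

theorem isTransverseAt_sum (A : Fin m → Matrix (Fin n) (Fin n) ℂ) :
    IsTransverseAt (fun A => ∑ j, A j) A := by
  refine ⟨fun j Y => A j * Y - Y * A j, fun j Y t => ?_, fun β hβ j => ?_⟩
  · simp only [Pi.add_apply, Pi.smul_apply, Finset.sum_add_distrib, ← Finset.smul_sum]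
    rw [Fintype.sum_pi_single']
  · have := commute_of_trace_mul_bracket (A := A j) (β := β) (γ := 1)
      fun Y => by rw [mul_one]; exact hβ j Y
    rw [one_mul] at this
    exact this.symm

/-- The product is affine in each single factor, so its derivative along `[A_j, Y]` is `P_j [A_j, Y]
S_{j+1}`, with `P` the partial products from the left and `S` the complementary ones, `S_k = P_k⁻¹`.
Orthogonality makes `S_k β P_k` independent of `k`, hence equal to `β`. So `β` commutes with all
`P_k`, and with `A_j = P_j⁻¹ P_{j+1}`. -/
theorem isTransverseAt_prod {A : Fin m → Matrix (Fin n) (Fin n) ℂ}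
    (hA : (List.ofFn A).prod = 1) : IsTransverseAt (fun A => (List.ofFn A).prod) A := by
  set P : ℕ → Matrix (Fin n) (Fin n) ℂ := fun k => ((List.ofFn A).take k).prod with hP
  set S : ℕ → Matrix (Fin n) (Fin n) ℂ := fun k => ((List.ofFn A).drop k).prod with hS
  have hPS : ∀ k, P k * S k = 1 := fun k => by rw [← hA, hP, hS, List.prod_take_mul_prod_drop]
  have hSP : ∀ k, S k * P k = 1 := fun k => mul_eq_one_comm.1 (hPS k)
  have hP1 : ∀ j : Fin m, P (j + 1) = P j * A j := fun j => by
    change ((List.ofFn A).take (j + 1)).prod = ((List.ofFn A).take j).prod * A j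
    rw [List.prod_take_succ _ _ (by simp)]
    simp
  have hS1 : ∀ j : Fin m, S j = A j * S (j + 1) := fun j => by
    change ((List.ofFn A).drop j).prod = A j * ((List.ofFn A).drop (j + 1)).prod
    rw [List.drop_eq_getElem_cons (by simp), List.prod_cons]
    simp
  have hset : ∀ (j : Fin m) (Z : Matrix (Fin n) (Fin n) ℂ),
      (List.ofFn (Function.update A j Z)).prod = P j * Z * S (j + 1) := by
    intro j Z
    have h1 : List.ofFn (Function.update A j Z) = (List.ofFn A).set j Z := by
      apply List.ext_getElem
      · simp
      · intro i h1 h2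
        simp only [List.getElem_ofFn, List.getElem_set, Function.update_apply, Fin.ext_iff]
        simp only [eq_comm]
    rw [h1, List.prod_set, if_pos (by simp)]
  refine ⟨fun j Y => P j * (A j * Y - Y * A j) * S (j + 1), fun j Y t => ?_, fun β hβ => ?_⟩
  · have h1 : A + t • Pi.single (M := fun _ => Matrix (Fin n) (Fin n) ℂ) j (A j * Y - Y * A j) =
        Function.update A j (A j + t • (A j * Y - Y * A j)) := by
      ext1 i
      by_cases hi : i = j
      · subst hi; simp
      · simp [Pi.single_eq_of_ne hi, Function.update_of_ne hi]
    have h2 := hset j (A j)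
    rw [Function.update_eq_self] at h2
    dsimp only
    rw [h1, hset, h2]
    simp only [mul_add, add_mul, Matrix.mul_smul, Matrix.smul_mul]
  · have hstep : ∀ j : Fin m, S (j + 1) * β * P (j + 1) = S j * β * P j := fun j => by
      have h1 := commute_of_trace_mul_bracket (A := A j) (β := β * P j) (γ := S (j + 1))
        fun Y => by
          have := hβ j Y
          simpa only [mul_assoc] using this
      rw [hP1, hS1]
      simpa only [mul_assoc] using h1
    have hconst : ∀ k, k ≤ m → S k * β * P k = β := by
      intro k
      induction k with
      | zero =>
        intro _
        have h1 : P 0 = 1 := rfl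
        have h2 : S 0 = 1 := hA
        rw [h1, h2, one_mul, mul_one]
      | succ k ih =>
        intro hk
        rw [hstep ⟨k, hk⟩]
        exact ih (by omega)
    have hcomm : ∀ k, k ≤ m → β * P k = P k * β := fun k hk => by
      conv_rhs => rw [← hconst k hk, ← mul_assoc, ← mul_assoc, hPS, one_mul]
    intro j
    have h1 := hcomm (j + 1) j.2
    rw [hP1, ← mul_assoc, hcomm j j.2.le, mul_assoc, mul_assoc] at h1
    have h2 := congrArg (S j * ·) h1
    simp only [← mul_assoc, hSP, one_mul] at h2
    exact h2.symm

theorem isPolyMap_sum : IsPolyMap fun A : Fin m → Matrix (Fin n) (Fin n) ℂ => ∑ j, A j := by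
  have := IsPolyMap.linear
    (∑ j, LinearMap.proj (R := ℂ) (φ := fun _ : Fin m => Matrix (Fin n) (Fin n) ℂ) j)
  simpa using! this

theorem isPolyMap_prod :
    IsPolyMap fun A : Fin m → Matrix (Fin n) (Fin n) ℂ => (List.ofFn A).prod := by
  simp only [List.ofFn_eq_map]
  exact IsPolyMap.list_prod (List.finRange m) fun j => IsPolyMap.linear
    (LinearMap.proj (R := ℂ) (φ := fun _ : Fin m => Matrix (Fin n) (Fin n) ℂ) j)

theorem IsConj.trace_eq {A B : Matrix (Fin n) (Fin n) ℂ} (h : IsConj A B) :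
    A.trace = B.trace := by
  obtain ⟨c, hc⟩ := h
  have h1 : A = ((c⁻¹ : (Matrix (Fin n) (Fin n) ℂ)ˣ) : Matrix (Fin n) (Fin n) ℂ) * (B * c) := by
    rw [← hc.eq, ← mul_assoc, Units.inv_mul, one_mul]
  rw [h1, Matrix.trace_mul_comm, mul_assoc, Units.mul_inv, mul_one]

theorem IsConj.det_eq {A B : Matrix (Fin n) (Fin n) ℂ} (h : IsConj A B) : A.det = B.det := by
  obtain ⟨c, hc⟩ := h
  have h1 := congrArg Matrix.det hc.eq
  rw [Matrix.det_mul, Matrix.det_mul, mul_comm] at h1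
  exact mul_right_cancel₀ ((Matrix.isUnit_iff_isUnit_det _).1 c.isUnit).ne_zero h1

/-- The trace of the sum is fixed by the classes, and with the other entries zero it equals the
missing diagonal entry. -/
theorem sum_eq_zero_of_entries {A B : Fin m → Matrix (Fin n) (Fin n) ℂ} (i₀ : Fin n)
    (h : ∀ j, IsConj (A j) (B j)) (hB : ∑ j, (B j).trace = 0)
    (hA : ∀ a b, (a, b) ≠ (i₀, i₀) → (∑ j, A j) a b = (0 : Matrix (Fin n) (Fin n) ℂ) a b) :
    ∑ j, A j = 0 := by
  have h1 : (∑ j, A j).trace = 0 := by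
    rw [Matrix.trace_sum, ← hB]
    exact Finset.sum_congr rfl fun j _ => (h j).trace_eq
  ext a b
  by_cases hab : (a, b) = (i₀, i₀)
  · obtain ⟨ha, hb⟩ := Prod.mk.inj hab
    rw [ha, hb]
    rw [Matrix.trace, Finset.sum_eq_single i₀] at h1
    · exact h1
    · intro k _ hk
      exact hA k k (by simp [hk])
    · simp
  · exact hA a b hab

/-- The other entries make the product diagonal with ones away from `i₀`, so its determinant, fixed
by the classes, is the missing entry. -/
theorem prod_eq_one_of_entries {A B : Fin m → Matrix (Fin n) (Fin n) ℂ} (i₀ : Fin n)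
    (h : ∀ j, IsConj (A j) (B j)) (hB : (List.ofFn fun j => (B j).det).prod = 1)
    (hA : ∀ a b, (a, b) ≠ (i₀, i₀) →
      (List.ofFn A).prod a b = (1 : Matrix (Fin n) (Fin n) ℂ) a b) :
    (List.ofFn A).prod = 1 := by
  have h1 : ((List.ofFn A).prod).det = 1 := by
    rw [← Matrix.coe_detMonoidHom, map_list_prod, List.map_ofFn, ← hB]
    congr 2
    ext j
    exact (h j).det_eq
  have h2 : (List.ofFn A).prod =
      Matrix.diagonal (Function.update 1 i₀ ((List.ofFn A).prod i₀ i₀)) := by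
    ext a b
    by_cases hab : (a, b) = (i₀, i₀)
    · obtain ⟨rfl, rfl⟩ := Prod.mk.inj hab
      simp
    · rw [hA a b hab]
      by_cases hab' : a = b
      · subst hab'
        have : a ≠ i₀ := fun h => hab (by rw [h])
        simp [Function.update_of_ne this]
      · rw [Matrix.one_apply_ne hab', Matrix.diagonal_apply_ne _ hab']
  rw [h2, Matrix.det_diagonal, Finset.prod_update_of_mem (Finset.mem_univ i₀)] at h1
  have h3 : (List.ofFn A).prod i₀ i₀ = 1 := by simpa using h1
  rw [h2, h3]
  have h4 : Function.update (1 : Fin n → ℂ) i₀ 1 = 1 := Function.update_eq_self i₀ 1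
  rw [h4]
  exact Matrix.diagonal_one

theorem additiveClass_mk (B : Matrix (Fin n) (Fin n) ℂ) :
    additiveClass (ConjClasses.mk B) = {M | IsConj M B} := by
  ext M
  rw [additiveClass, ConjClasses.mem_carrier_iff_mk_eq, ConjClasses.mk_eq_mk_iff_isConj]
  rfl

theorem multiplicativeClass_mk (B : Matrix.GeneralLinearGroup (Fin n) ℂ) :
    multiplicativeClass (ConjClasses.mk B) =
      {M | IsConj M (B : Matrix (Fin n) (Fin n) ℂ)} := by
  ext M
  constructor
  · rintro ⟨M, hM, rfl⟩
    rw [ConjClasses.mem_carrier_iff_mk_eq, ConjClasses.mk_eq_mk_iff_isConj] at hM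
    exact MonoidHom.map_isConj (Units.coeHom _) hM
  · intro h
    obtain ⟨c, hc⟩ := h.symm
    refine ⟨c * B * c⁻¹, ?_, ?_⟩
    · rw [ConjClasses.mem_carrier_iff_mk_eq, ConjClasses.mk_eq_mk_iff_isConj]
      exact (isConj_iff.2 ⟨c, rfl⟩).symm
    · change (c : Matrix (Fin n) (Fin n) ℂ) * B * ((c⁻¹ : (Matrix (Fin n) (Fin n) ℂ)ˣ) : _) = M
      rw [hc.eq, mul_assoc, Units.mul_inv, mul_one]

end

end

/-! ### The main theorem -/

theorem proposition1p18 (n p : ℕ) (hn : 1 ≤ n) :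
    (∀ (c : Fin (p + 1) → ConjClasses (Matrix (Fin n) (Fin n) ℂ)) (κ : ℤ),
      κ = rigidityIndex (fun j => additiveClass (c j)) →
      (additiveTuples (fun j => additiveClass (c j))).Nonempty →
      ∃ d : ℕ, (d : ℤ) = (n : ℤ) ^ 2 + 1 - κ ∧
        IsSmoothVariety (tuplePoints (additiveTuples (fun j => additiveClass (c j)))) d ∧
        varietyDim (tuplePoints (additiveTuples (fun j => additiveClass (c j)))) = d) ∧
    (∀ (C : Fin (p + 1) → ConjClasses (Matrix.GeneralLinearGroup (Fin n) ℂ)) (κ : ℤ),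
      κ = rigidityIndex (fun j => multiplicativeClass (C j)) →
      (multiplicativeTuples (fun j => multiplicativeClass (C j))).Nonempty →
      ∃ d : ℕ, (d : ℤ) = (n : ℤ) ^ 2 + 1 - κ ∧
        IsSmoothVariety (tuplePoints (multiplicativeTuples (fun j => multiplicativeClass (C j)))) d ∧
        varietyDim (tuplePoints (multiplicativeTuples (fun j => multiplicativeClass (C j)))) = d) := by
  constructor
  · rintro c κ rfl hne
    choose B hB using fun j => (c j).exists_rep
    have hcls : (fun j => additiveClass (c j)) = fun j => {M | IsConj M (B j)} :=
      funext fun j => by rw [← additiveClass_mk]; exact congrArg _ (hB j).symm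
    rw [hcls] at hne ⊢
    obtain ⟨A, hA, hA0, hAc⟩ := hne
    refine relationTuples_smooth hn ⟨0, hn⟩ isPolyMap_sum
      (fun X hX => sum_eq_zero_of_entries ⟨0, hn⟩ hX ?_)
      (fun X _ => isTransverseAt_sum X) ⟨A, hA, hA0, hAc⟩
    -- The trace condition on the classes is read off from the given solution `A`; the determinant
    -- condition in the other case is obtained likewise.
    rw [← Finset.sum_congr rfl fun j _ => (hA j).trace_eq, ← Matrix.trace_sum, hA0,
      Matrix.trace_zero]
  · rintro C κ rfl hne
    choose B hB using fun j => (C j).exists_rep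
    have hcls : (fun j => multiplicativeClass (C j)) =
        fun j => {M | IsConj M (B j : Matrix (Fin n) (Fin n) ℂ)} :=
      funext fun j => by rw [← multiplicativeClass_mk]; exact congrArg _ (hB j).symm
    rw [hcls] at hne ⊢
    obtain ⟨A, hA, hA1, hAc⟩ := hne
    refine relationTuples_smooth hn ⟨0, hn⟩ isPolyMap_prod
      (fun X hX => prod_eq_one_of_entries ⟨0, hn⟩ hX ?_)
      (fun X hX => isTransverseAt_prod hX) ⟨A, hA, hA1, hAc⟩
    rw [← Matrix.det_one (n := Fin n) (R := ℂ), ← hA1, ← Matrix.coe_detMonoidHom,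
      map_list_prod, List.map_ofFn]
    congr 2
    ext j
    exact (hA j).det_eq.symm
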